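/- Let $H$ be a (real or complex) separable Hilbert space and $A$ a positive self-adjoint unbounded operator in $H$ with domain $D(A)$, which has a complete orthonormal system of eigenvectors $\{v_k\}_{k\ge1}$, $Av_k=\lambda_kv_k$, with $0<\lambda_1\le\lambda_2\le\cdots\to+\infty$. For $h\in H$ write $h_k=(h,v_k)$. Let $0<\alpha<1$, $\beta>-\alpha$, $\mu>-1$, $T>0$, and let $I$ be one of the intervals $(0,T]$ and $(0,\infty)$. For $t>0$ let $$J^{\alpha-1}u(t)=\frac1{\Gamma(1-\alpha)}\int_0^t\frac{u(\xi)}{(t-\xi)^{\alpha}}\,d\xi,\qquad \partial_t^\alpha u(t)=\frac{d}{dt}J^{\alpha-1}u(t)$$ (Bochner integral, strong derivative; if $I=(0,T]$, the derivative at $t=T$ is one-sided), and let $$E_{\alpha,m,l}(z)=\sum_{k=0}^\infty c_kz^k,\qquad c_0=1,\quad c_k=\prod_{j=0}^{k-1}\frac{\Gamma(\alpha(jm+l)+1)}{\Gamma(\alpha(jm+l+1)+1)}$$ be the Kilbas–Saigo (three-parameter Mittag-Leffler) function. Given $\varphi,\Psi\in H$, a solution of the inverse problem on $I$ is a pair $\{u,f\}$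 with $f\in H$ and $u:I\to H$ such that $u$ is continuous on $I$, $J^{\alpha-1}u$ exists on $I$ and extends continuously to $I\cup\{0\}$, $\partial_t^\alpha u$ and $Au$ exist and are continuous on $I$, and $$\partial_t^\alpha u(t)+t^\beta Au(t)=t^\mu f\quad(t\in I),\qquad \lim_{t\to+0}J^{\alpha-1}u(t)=\varphi,\qquad u(T)=\Psi .$$ Theorem. If $\varphi,\Psi\in D(A)$, then the inverse problem has a unique solution $\{u,f\}$ on $I$, and it has the form $$u(t)=\sum_{k=1}^\infty\left[\frac{\varphi_k}{\Gamma(\alpha)}t^{\alpha-1}E_{\alpha,1+\frac\beta\alpha,1+\frac{\beta-1}\alpha}(-\lambda_kt^{\alpha+\beta})+\frac{\Gamma(\mu+1)f_k}{\Gamma(\mu+\alpha+1)}t^{\alpha+\mu}E_{\alpha,1+\frac\beta\alpha,1+\frac{\beta+\mu}\alpha}(-\lambda_kt^{\alpha+\beta})\right]v_k\quad(t\in I),$$ where $f=\sum_{k=1}^\infty f_kv_k$ and $$f_k=\frac{\Psi_k\,\Gamma(\mu+\alpha+1)}{\Gamma(\mu+1)T^{\alpha+\mu}E_{\alpha,1+\frac\beta\alpha,1+\frac{\beta+\mu}\alpha}(-\lambda_kT^{\alpha+\beta})}-\frac{\varphi_k\,T^{\alpha-1}E_{\alpha,1+\frac\beta\alpha,1+\frac{\beta-1}\alpha}(-\lambda_kT^{\alpha+\beta})\,\Gamma(\mu+\alpha+1)}{\Gamma(\alpha)\Gamma(\mu+1)T^{\alpha+\mu}E_{\alpha,1+\frac\beta\alpha,1+\frac{\beta+\mu}\alpha}(-\lambda_kT^{\alpha+\beta})},$$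 the denominators being nonzero. -/

import Mathlib

open Set Filter Topology MeasureTheory

noncomputable section

/-- Coefficients of the Kilbas–Saigo function:
`c₀ = 1`, `c_k = ∏_{j<k} Γ(α(jm+l)+1) / Γ(α(jm+l+1)+1)`. -/
def kilbasSaigoCoeff (α m l : ℝ) (k : ℕ) : ℝ :=
  ∏ j ∈ Finset.range k,
    Real.Gamma (α * (j * m + l) + 1) / Real.Gamma (α * (j * m + l + 1) + 1)

/-- The three-parameter Mittag-Leffler (Kilbas–Saigo) function
`E_{α,m,l}(z) = ∑ₖ c_k z^k`, for real parameters and a real argument. -/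
def kilbasSaigo (α m l z : ℝ) : ℝ :=
  ∑' k : ℕ, kilbasSaigoCoeff α m l k * z ^ k

/-- The Riemann–Liouville integral
`J^σ h(t) = (1 / Γ(-σ)) ∫₀ᵗ h(ξ) / (t-ξ)^(σ+1) dξ` (for `σ < 0`) of a vector-valued function. -/
def rlJ {H : Type*} [NormedAddCommGroup H] [NormedSpace ℝ H]
    (σ : ℝ) (h : ℝ → H) (t : ℝ) : H :=
  (Real.Gamma (-σ))⁻¹ • ∫ ξ in (0 : ℝ)..t, ((t - ξ) ^ (σ + 1))⁻¹ • h ξ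

/-- The Riemann–Liouville derivative `∂_t^α h = (d/dt) J^(α-1) h` on the time interval `I`
(`I = (0, T]` or `I = (0, ∞)`; at a right end point contained in `I` the derivative is
one-sided). -/
def rlDeriv {H : Type*} [NormedAddCommGroup H] [NormedSpace ℝ H]
    (I : Set ℝ) (α : ℝ) (h : ℝ → H) (t : ℝ) : H :=
  derivWithin (rlJ (α - 1) h) I t

/-- `u` solves `∂_t^α u(t) + t^β A u(t) = t^μ f` for `t ∈ I`, with
`lim_{t → +0} J^(α-1) u(t) = φ`. Here `I` is a time interval with left end point `0`,
which does not belong to `I`. -/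
structure IsForwardSolution {𝕜 : Type*} [RCLike 𝕜] {H : Type*} [NormedAddCommGroup H]
    [InnerProductSpace 𝕜 H] [NormedSpace ℝ H]
    (A : H →ₗ.[𝕜] H) (α β μ : ℝ) (f φ : H) (I : Set ℝ) (u : ℝ → H) : Prop where
  /-- `u ∈ C(I; H)` -/
  continuousOn : ContinuousOn u I
  /-- the (Bochner) integral that defines `J^(α-1) u(t)` exists -/
  integrable : ∀ t ∈ I,
    IntervalIntegrable (fun ξ => ((t - ξ) ^ (α - 1 + 1))⁻¹ • u ξ) volume 0 t
  /-- `J^(α-1) u ∈ C(I; H)`. -/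
  continuousOn_rlJ : ContinuousOn (rlJ (α - 1) u) I
  /-- The initial condition; it also says that `J^(α-1) u` extends continuously to `t = 0`. -/
  initial : Tendsto (rlJ (α - 1) u) (𝓝[>] 0) (𝓝 φ)
  /-- `∂_t^α u` exists on `I` -/
  differentiableOn : DifferentiableOn ℝ (rlJ (α - 1) u) I
  /-- `∂_t^α u ∈ C(I; H)` -/
  continuousOn_rlDeriv : ContinuousOn (rlDeriv I α u) I
  /-- `u(t) ∈ D(A)` -/
  mem_domain : ∀ t ∈ I, u t ∈ A.domain
  /-- `A u ∈ C(I; H)` -/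
  continuous_apply : Continuous fun t : I => A ⟨u t, mem_domain t t.2⟩
  /-- the equation -/
  equation : ∀ (t : ℝ) (ht : t ∈ I),
    rlDeriv I α u t + (t ^ β : ℝ) • A ⟨u t, mem_domain t ht⟩ = (t ^ μ : ℝ) • f

/-- The pair `(u, f)` solves the inverse problem with final-time condition `u(T) = Ψ`. -/
structure IsInverseSolution {𝕜 : Type*} [RCLike 𝕜] {H : Type*} [NormedAddCommGroup H]
    [InnerProductSpace 𝕜 H] [NormedSpace ℝ H]
    (A : H →ₗ.[𝕜] H) (α β μ T : ℝ) (φ Ψ : H) (I : Set ℝ) (u : ℝ → H) (f : H) : Prop where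
  forward : IsForwardSolution A α β μ f φ I u
  final : u T = Ψ

end

/-! In the eigenbasis the problem splits into scalar equations ∂_t^α y + λ t^β y = t^μ f with λ =
λ_k. For y(t) = t^(α+μ)/Γ(α+μ+1) · E(-λ t^(α+β)) (`ksSol`), termwise Beta integrals give J^(α-1) y =
t^(μ+1)/Γ(μ+2) - λ ∫₀ᵗ s^β y ds (`rlJ_ksSol`). The value μ = -1 is admitted: the first term is then
1, so the same function carries the initial datum, and one set of lemmas serves both terms of the
series.

Convergence needs bounds for E(-x), x > 0: it lies in [0, 1] and decreases, x E(-x) is bounded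
(`mul_ksFun_neg_le`), and for μ > -1 it is at least c/(1+x) (`ksFun_neg_lower`). They follow from an
extremum principle (`rlJ_hasDerivAt_nonpos`): where a nonnegative function first touches zero, its
fractional derivative is nonpositive. Applied to combinations of scalar solutions, it excludes sign
changes.

Existence: |E| ≤ 1 makes the series for u converge. For Au, the initial part uses φ ∈ D(A), while
boundedness of λE(-λt^(α+β)) handles any f ∈ H. The equation is verified in integrated form,
coefficient by coefficient, and then differentiated (`isForwardSolution_seriesSol`).

Uniqueness: each coefficient of a solution differs from the scalar solution by a solution z of the
homogeneous equation. Abel inversion recovers ∫z from w = J^(α-1) z, and a contraction in an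
exponentially weighted sup norm gives w = 0, hence z = 0 (`eq_zero_of_homogeneous`).

The condition u(T) = Ψ is one linear equation for each f_k. Its coefficient is positive and at least
a constant times 1/λ_k (`exists_inv_ksSol_le`), so |f_k| ≤ Cλ_k(|Ψ_k| + P|φ_k|), which is square
summable because φ, Ψ ∈ D(A). -/

noncomputable section

/-! ### Beta integrals -/

lemma intervalIntegrable_beta_one {p q : ℝ} (hp : 0 < p) (hq : 0 < q) :
    IntervalIntegrable (fun s : ℝ => s ^ (p - 1) * (1 - s) ^ (q - 1)) volume 0 1 := by
  have h := (Complex.betaIntegral_convergent (u := p) (v := q) (by simpa) (by simpa)).norm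
  refine h.congr ?_
  intro s hs
  rw [uIoc_of_le zero_le_one] at hs
  rcases eq_or_lt_of_le hs.2 with rfl | h1
  · simp only [Complex.ofReal_one, Complex.one_cpow, sub_self, one_mul, Real.one_rpow]
    norm_cast
    -- At s = 1 the factor is 0^(q-1), which by convention is 1 for q = 1 and 0 otherwise, over ℝ
    -- and over ℂ alike.
    by_cases hq1 : q - 1 = 0
    · simp [hq1]
    · rw [Real.zero_rpow hq1]
      have hq2 : (q : ℂ) - 1 ≠ 0 := by exact_mod_cast hq1
      simp [Complex.zero_cpow hq2]
  · have h1' : (0 : ℝ) < 1 - s := by linarith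
    have e1 : (1 - (s : ℂ)) = ((1 - s : ℝ) : ℂ) := by push_cast; ring
    simp only [norm_mul]
    rw [Complex.norm_cpow_eq_rpow_re_of_pos hs.1, e1, Complex.norm_cpow_eq_rpow_re_of_pos h1']
    simp

lemma intervalIntegrable_beta {p q t : ℝ} (hp : 0 < p) (hq : 0 < q) (ht : 0 < t) :
    IntervalIntegrable (fun s : ℝ => (t - s) ^ (q - 1) * s ^ (p - 1)) volume 0 t := by
  have h := (intervalIntegrable_beta_one hp hq).comp_mul_left (c := t⁻¹)
  have h2 := h.const_mul (t ^ (p - 1) * t ^ (q - 1))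
  have e : (1 : ℝ) / t⁻¹ = t := by simp
  simp only [zero_div, e] at h2
  refine h2.congr ?_
  intro s hs
  rw [uIoc_of_le ht.le] at hs
  have e2 : 1 - t⁻¹ * s = t⁻¹ * (t - s) := by field_simp
  have ht' : 0 ≤ t⁻¹ := by positivity
  simp only [e2]
  rw [Real.mul_rpow ht' hs.1.le, Real.mul_rpow ht' (by linarith [hs.2]), Real.inv_rpow ht.le,
    Real.inv_rpow ht.le]
  have a1 : t ^ (p - 1) ≠ 0 := (Real.rpow_pos_of_pos ht _).ne'
  have a2 : t ^ (q - 1) ≠ 0 := (Real.rpow_pos_of_pos ht _).ne'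
  field_simp

lemma integral_beta {p q t : ℝ} (hp : 0 < p) (hq : 0 < q) (ht : 0 < t) :
    ∫ s in (0 : ℝ)..t, (t - s) ^ (q - 1) * s ^ (p - 1) =
      t ^ (p + q - 1) * (Real.Gamma p * Real.Gamma q / Real.Gamma (p + q)) := by
  have h := Complex.betaIntegral_scaled p q ht
  rw [Complex.betaIntegral_eq_Gamma_mul_div _ _ (by simpa) (by simpa)] at h
  have e1 : ∫ x in (0 : ℝ)..t, (x : ℂ) ^ ((p : ℂ) - 1) * ((t : ℂ) - x) ^ ((q : ℂ) - 1) =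
      ∫ s in (0 : ℝ)..t, (((t - s) ^ (q - 1) * s ^ (p - 1) : ℝ) : ℂ) := by
    refine intervalIntegral.integral_congr fun s hs => ?_
    rw [uIcc_of_le ht.le] at hs
    rw [Complex.ofReal_mul, Complex.ofReal_cpow (by linarith [hs.2]), Complex.ofReal_cpow hs.1]
    push_cast
    ring
  rw [e1, intervalIntegral.integral_ofReal] at h
  apply Complex.ofReal_injective
  rw [h]
  rw [Complex.ofReal_mul, Complex.ofReal_cpow ht.le]
  push_cast
  rw [← Complex.ofReal_add, Complex.Gamma_ofReal, Complex.Gamma_ofReal, Complex.Gamma_ofReal]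

/-! ### Growth of the Gamma function -/

/-- Log-convexity of Γ at x + 1 = α(x+α) + (1-α)(x+α+1), followed by the functional equation at x
and at x+α. -/
lemma Gamma_div_Gamma_add_le {α x : ℝ} (hα0 : 0 < α) (hα1 : α < 1) (hx : 0 < x) :
    Real.Gamma x / Real.Gamma (x + α) ≤ (x + α) ^ (1 - α) / x := by
  have hxa : 0 < x + α := by linarith
  have h := Real.Gamma_mul_add_mul_le_rpow_Gamma_mul_rpow_Gamma (s := x + α) (t := x + α + 1)
    (a := α) (b := 1 - α) hxa (by linarith) hα0 (by linarith) (by ring)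
  have e : α * (x + α) + (1 - α) * (x + α + 1) = x + 1 := by ring
  have hG := Real.Gamma_pos_of_pos hxa
  rw [e, Real.Gamma_add_one hx.ne', Real.Gamma_add_one hxa.ne',
    Real.mul_rpow hxa.le hG.le] at h
  have e2 : Real.Gamma (x + α) ^ α * ((x + α) ^ (1 - α) * Real.Gamma (x + α) ^ (1 - α)) =
      (x + α) ^ (1 - α) * Real.Gamma (x + α) := by
    calc _ = (x + α) ^ (1 - α) * (Real.Gamma (x + α) ^ α * Real.Gamma (x + α) ^ (1 - α)) := by ring
      _ = _ := by rw [← Real.rpow_add hG]; simp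
  rw [e2] at h
  rw [div_le_div_iff₀ hG hx]
  linarith

lemma tendsto_Gamma_div_Gamma_add {α : ℝ} (hα0 : 0 < α) (hα1 : α < 1) :
    Tendsto (fun x => Real.Gamma x / Real.Gamma (x + α)) atTop (𝓝 0) := by
  have h1 : Tendsto (fun x : ℝ => 2 * x ^ (-α)) atTop (𝓝 0) := by
    simpa using (tendsto_rpow_neg_atTop hα0).const_mul 2
  refine tendsto_of_tendsto_of_tendsto_of_le_of_le' tendsto_const_nhds h1 ?_ ?_
  · filter_upwards [eventually_gt_atTop 0] with x hx
    exact div_nonneg (Real.Gamma_pos_of_pos hx).le (Real.Gamma_pos_of_pos (by linarith)).le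
  · filter_upwards [eventually_ge_atTop 1] with x hx
    have hx0 : 0 < x := by linarith
    refine (Gamma_div_Gamma_add_le hα0 hα1 hx0).trans ?_
    rw [div_le_iff₀ hx0]
    have e : 2 * x ^ (-α) * x = 2 * x ^ (1 - α) := by
      rw [mul_assoc, ← Real.rpow_add_one hx0.ne']; ring_nf
    rw [e]
    calc (x + α) ^ (1 - α) ≤ (2 * x) ^ (1 - α) :=
          Real.rpow_le_rpow (by linarith) (by linarith) (by linarith)
      _ = 2 ^ (1 - α) * x ^ (1 - α) := Real.mul_rpow (by norm_num) hx0.le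
      _ ≤ 2 * x ^ (1 - α) := by
          gcongr
          calc (2 : ℝ) ^ (1 - α) ≤ 2 ^ (1 : ℝ) :=
                Real.rpow_le_rpow_of_exponent_le (by norm_num) (by linarith)
            _ = 2 := by simp

/-! ### The Kilbas–Saigo functions of the problem -/

/-- The coefficients of `E_{α,1+β/α,1+(β+μ)/α}`. -/
def ksCoeff (α β μ : ℝ) (k : ℕ) : ℝ :=
  kilbasSaigoCoeff α (1 + β / α) (1 + (β + μ) / α) k

/-- The function `E_{α,1+β/α,1+(β+μ)/α}`. -/
def ksFun (α β μ x : ℝ) : ℝ :=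
  kilbasSaigo α (1 + β / α) (1 + (β + μ) / α) x

lemma ksFun_eq_tsum (α β μ x : ℝ) : ksFun α β μ x = ∑' k, ksCoeff α β μ k * x ^ k := rfl

lemma ksCoeff_zero (α β μ : ℝ) : ksCoeff α β μ 0 = 1 := by
  simp [ksCoeff, kilbasSaigoCoeff]

/-- With these parameters α(jm+l)+1 = μ+1+(j+1)(α+β), which is positive even for μ = -1. -/
lemma ksCoeff_succ {α β μ : ℝ} (hα : 0 < α) (k : ℕ) :
    ksCoeff α β μ (k + 1) = ksCoeff α β μ k *
      (Real.Gamma (μ + 1 + (k + 1) * (α + β)) / Real.Gamma (μ + 1 + (k + 1) * (α + β) + α)) := by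
  unfold ksCoeff kilbasSaigoCoeff
  rw [Finset.prod_range_succ]
  congr 3 <;> · field_simp; ring

section
variable {α β μ : ℝ} (hα0 : 0 < α) (hα1 : α < 1) (hβ : -α < β) (hμ : -1 ≤ μ)
include hα0 hβ hμ

lemma ksCoeff_pos (k : ℕ) : 0 < ksCoeff α β μ k := by
  induction k with
  | zero => simp [ksCoeff_zero]
  | succ k ih =>
    rw [ksCoeff_succ hα0]
    have : 0 < μ + 1 + (k + 1) * (α + β) := by
      have : 0 < (k + 1) * (α + β) := mul_pos (by positivity) (by linarith)
      linarith
    exact mul_pos ih (div_pos (Real.Gamma_pos_of_pos this) (Real.Gamma_pos_of_pos (by linarith)))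

include hα1

/-- The ratio is Γ(x)/Γ(x+α) at a point x that grows linearly in n. This makes the radius of
convergence infinite. -/
lemma ksCoeff_ratio_tendsto :
    Tendsto (fun n => ‖ksCoeff α β μ n.succ‖ / ‖ksCoeff α β μ n‖) atTop (𝓝 0) := by
  have hd : 0 < α + β := by linarith
  have h1 : Tendsto (fun k : ℕ => μ + 1 + ((k : ℝ) + 1) * (α + β)) atTop atTop := by
    refine tendsto_atTop_add_const_left _ _ ?_
    refine Tendsto.atTop_mul_const hd ?_
    exact tendsto_atTop_add_const_right _ _ tendsto_natCast_atTop_atTop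
  refine ((tendsto_Gamma_div_Gamma_add hα0 hα1).comp h1).congr fun n => ?_
  have hp := ksCoeff_pos hα0 hβ hμ n
  have hp' := ksCoeff_pos hα0 hβ hμ (n + 1)
  rw [Real.norm_of_nonneg hp.le, Real.norm_of_nonneg hp'.le, ksCoeff_succ hα0]
  simp only [Function.comp]
  field_simp

lemma ksCoeff_radius :
    (FormalMultilinearSeries.ofScalars ℝ (ksCoeff α β μ)).radius = ⊤ :=
  FormalMultilinearSeries.ofScalars_radius_eq_top_of_tendsto ℝ _
    (Eventually.of_forall fun n => (ksCoeff_pos hα0 hβ hμ n).ne')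
    (ksCoeff_ratio_tendsto hα0 hα1 hβ hμ)

lemma summable_ksCoeff (x : ℝ) : Summable fun k => ksCoeff α β μ k * |x| ^ k := by
  have h := (FormalMultilinearSeries.ofScalars ℝ (ksCoeff α β μ)).summable_norm_mul_pow
    (r := ⟨|x|, abs_nonneg x⟩) (by rw [ksCoeff_radius hα0 hα1 hβ hμ]; exact ENNReal.coe_lt_top)
  refine h.congr fun k => ?_
  rw [FormalMultilinearSeries.ofScalars_norm, Real.norm_of_nonneg (ksCoeff_pos hα0 hβ hμ k).le]
  rfl

lemma differentiable_ksFun : Differentiable ℝ (ksFun α β μ) := by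
  have h := (FormalMultilinearSeries.ofScalars ℝ (ksCoeff α β μ)).hasFPowerSeriesOnBall
    (by rw [ksCoeff_radius hα0 hα1 hβ hμ]; simp)
  rw [ksCoeff_radius hα0 hα1 hβ hμ] at h
  have e : (FormalMultilinearSeries.ofScalars ℝ (ksCoeff α β μ)).sum = ksFun α β μ := by
    ext x
    have := FormalMultilinearSeries.ofScalars_sum_eq (E := ℝ) (ksCoeff α β μ) x
    simpa [FormalMultilinearSeries.ofScalarsSum, ksFun_eq_tsum] using this
  rw [e] at h
  intro x
  exact (h.differentiableOn x (by simp)).differentiableAt (by simp)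

omit hα0 hα1 hβ hμ in
lemma ksFun_zero : ksFun α β μ 0 = 1 := by
  rw [ksFun_eq_tsum, tsum_eq_single 0]
  · simp [ksCoeff_zero]
  · intro k hk; simp [hk]

end

/-! ### Termwise integration and the scalar equation -/

/-- Dominated convergence with bound |g(s)| ∑ |a_k| t^(dk). Both integrals in the scalar equation
are expanded this way. -/
lemma hasSum_integral_mul_rpow_series {g : ℝ → ℝ} {a : ℕ → ℝ} {d t : ℝ} (hd : 0 < d) (ht : 0 < t)
    (hg : IntervalIntegrable g volume 0 t) (ha : Summable fun k => |a k| * (t ^ d) ^ k) :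
    HasSum (fun k => ∫ s in (0 : ℝ)..t, g s * (a k * (s ^ d) ^ k))
      (∫ s in (0 : ℝ)..t, g s * ∑' k, a k * (s ^ d) ^ k) := by
  have hc : Continuous fun s : ℝ => s ^ d := Real.continuous_rpow_const hd.le
  have hbd : ∀ s ∈ uIoc 0 t, ∀ k, |a k * (s ^ d) ^ k| ≤ |a k| * (t ^ d) ^ k := by
    intro s hs k
    rw [uIoc_of_le ht.le] at hs
    have h1 : 0 ≤ s ^ d := Real.rpow_nonneg hs.1.le _
    rw [abs_mul, abs_of_nonneg (pow_nonneg h1 k)]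
    have : s ^ d ≤ t ^ d := Real.rpow_le_rpow hs.1.le hs.2 hd.le
    gcongr
  refine intervalIntegral.hasSum_integral_of_dominated_convergence
    (fun k s => |g s| * (|a k| * (t ^ d) ^ k)) ?_ ?_ ?_ ?_ ?_
  · intro k
    have h1 : AEStronglyMeasurable g (volume.restrict (uIoc 0 t)) := by
      have := hg.aestronglyMeasurable
      rwa [← uIoc_of_le ht.le] at this
    exact h1.mul (by fun_prop)
  · intro k
    refine Eventually.of_forall fun s hs => ?_
    rw [norm_mul, Real.norm_eq_abs, Real.norm_eq_abs]
    exact mul_le_mul_of_nonneg_left (hbd s hs k) (abs_nonneg _)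
  · exact Eventually.of_forall fun s _ => ha.mul_left _
  · simp only [tsum_mul_left]
    exact hg.abs.mul_const _
  · refine Eventually.of_forall fun s hs => ?_
    refine HasSum.mul_left _ (Summable.hasSum ?_)
    exact Summable.of_norm_bounded ha (hbd s hs)

/-- The Kilbas–Saigo solution `t^(α+μ) / Γ(α+μ+1) * E(-λ t^(α+β))`. -/
def ksSol (α β μ lam t : ℝ) : ℝ :=
  t ^ (α + μ) / Real.Gamma (α + μ + 1) * ksFun α β μ (-lam * t ^ (α + β))

section
variable {α β μ : ℝ} (hα0 : 0 < α) (hα1 : α < 1) (hβ : -α < β) (hμ : -1 ≤ μ)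
include hα0 hα1 hβ hμ

lemma continuous_ksFun_comp (lam : ℝ) :
    Continuous fun s : ℝ => ksFun α β μ (-lam * s ^ (α + β)) := by
  have h1 := (differentiable_ksFun hα0 hα1 hβ hμ).continuous
  have h2 : Continuous fun s : ℝ => s ^ (α + β) := Real.continuous_rpow_const (by linarith)
  fun_prop

lemma differentiableAt_ksSol (lam : ℝ) {t : ℝ} (ht : 0 < t) :
    DifferentiableAt ℝ (ksSol α β μ lam) t := by
  have h1 : DifferentiableAt ℝ (fun s : ℝ => s ^ (α + μ)) t :=
    Real.differentiableAt_rpow_const_of_ne _ ht.ne'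
  have h2 : DifferentiableAt ℝ (fun s : ℝ => -lam * s ^ (α + β)) t :=
    (Real.differentiableAt_rpow_const_of_ne _ ht.ne').const_mul _
  have h3 := (differentiable_ksFun hα0 hα1 hβ hμ (-lam * t ^ (α + β))).comp t h2
  exact (h1.div_const _).mul h3

lemma continuousOn_ksSol (lam : ℝ) : ContinuousOn (ksSol α β μ lam) (Ioi 0) := fun _ ht =>
  (differentiableAt_ksSol hα0 hα1 hβ hμ lam ht).continuousAt.continuousWithinAt

lemma intervalIntegrable_rpow_mul_ksSol (lam : ℝ) {t : ℝ} (ht : 0 < t) :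
    IntervalIntegrable (fun s => s ^ β * ksSol α β μ lam s) volume 0 t := by
  have h1 : IntervalIntegrable (fun s : ℝ => s ^ (μ + (α + β))) volume 0 t :=
    intervalIntegral.intervalIntegrable_rpow' (by linarith)
  have h2 := (h1.div_const (Real.Gamma (α + μ + 1))).mul_continuousOn
    (continuous_ksFun_comp hα0 hα1 hβ hμ lam).continuousOn
  refine h2.congr fun s hs => ?_
  rw [uIoc_of_le ht.le] at hs
  have e : μ + (α + β) = β + (α + μ) := by ring
  simp only [ksSol]
  rw [e, Real.rpow_add hs.1]
  ring

lemma intervalIntegrable_kernel_mul_ksSol (lam : ℝ) {t : ℝ} (ht : 0 < t) :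
    IntervalIntegrable (fun s => ((t - s) ^ (α - 1 + 1))⁻¹ • ksSol α β μ lam s) volume 0 t := by
  have h1 := intervalIntegrable_beta (p := α + μ + 1) (q := 1 - α) (by linarith) (by linarith) ht
  have h2 := (h1.div_const (Real.Gamma (α + μ + 1))).mul_continuousOn
    (continuous_ksFun_comp hα0 hα1 hβ hμ lam).continuousOn
  refine h2.congr fun s hs => ?_
  rw [uIoc_of_le ht.le] at hs
  have e1 : α + μ + 1 - 1 = α + μ := by ring
  have e2 : 1 - α - 1 = -(α - 1 + 1) := by ring
  simp only [ksSol, smul_eq_mul]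
  rw [e1, e2, Real.rpow_neg (by linarith [hs.2])]
  ring

/-- The scalar equation in integrated form. -/
lemma rlJ_ksSol (lam : ℝ) {t : ℝ} (ht : 0 < t) :
    rlJ (α - 1) (ksSol α β μ lam) t =
      t ^ (μ + 1) / Real.Gamma (μ + 2) - lam * ∫ s in (0 : ℝ)..t, s ^ β * ksSol α β μ lam s := by
  have hd : 0 < α + β := by linarith
  have hG0 : Real.Gamma (α + μ + 1) ≠ 0 := (Real.Gamma_pos_of_pos (by linarith)).ne'
  have hG1 : Real.Gamma (1 - α) ≠ 0 := (Real.Gamma_pos_of_pos (by linarith)).ne'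
  set b : ℕ → ℝ := fun k => ksCoeff α β μ k * (-lam) ^ k / Real.Gamma (α + μ + 1) with hb
  have hbsum : Summable fun k => |b k| * (t ^ (α + β)) ^ k := by
    refine ((summable_ksCoeff hα0 hα1 hβ hμ (lam * t ^ (α + β))).div_const
      |Real.Gamma (α + μ + 1)|).congr fun k => ?_
    rw [hb]
    simp only
    rw [abs_div, abs_mul (ksCoeff α β μ k), abs_of_pos (ksCoeff_pos hα0 hβ hμ k), abs_pow,
      abs_neg, abs_mul lam,
      abs_of_pos (Real.rpow_pos_of_pos ht _), mul_pow]
    ring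
  have hexp : ∀ s : ℝ, ksSol α β μ lam s =
      s ^ (α + μ) * ∑' k, b k * (s ^ (α + β)) ^ k := by
    intro s
    rw [ksSol, ksFun_eq_tsum, div_mul_eq_mul_div, mul_div_assoc, ← tsum_div_const]
    congr 2
    ext k
    rw [hb]
    simp only
    rw [mul_pow]
    ring
  have hpow : ∀ (s : ℝ) (k : ℕ), 0 < s → (s ^ (α + β)) ^ k = s ^ (k * (α + β)) := by
    intro s k hs
    rw [← Real.rpow_natCast, ← Real.rpow_mul hs.le]
    ring_nf
  -- left-hand side
  have hL := hasSum_integral_mul_rpow_series hd ht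
    (intervalIntegrable_beta (p := α + μ + 1) (q := 1 - α) (by linarith) (by linarith) ht) hbsum
  have hLk : ∀ k : ℕ, ∫ s in (0 : ℝ)..t,
      (t - s) ^ (1 - α - 1) * s ^ (α + μ + 1 - 1) * (b k * (s ^ (α + β)) ^ k) =
      Real.Gamma (1 - α) * (b k * t ^ (μ + 1 + k * (α + β)) *
        (Real.Gamma (α + μ + 1 + k * (α + β)) / Real.Gamma (μ + 2 + k * (α + β)))) := by
    intro k
    have hk : 0 ≤ k * (α + β) := by positivity
    have := integral_beta (p := α + μ + 1 + k * (α + β)) (q := 1 - α) (by linarith) (by linarith) ht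
    have e1 : α + μ + 1 + k * (α + β) + (1 - α) - 1 = μ + 1 + k * (α + β) := by ring
    have e2 : α + μ + 1 + k * (α + β) + (1 - α) = μ + 2 + k * (α + β) := by ring
    rw [e1, e2] at this
    calc _ = b k * ∫ s in (0 : ℝ)..t, (t - s) ^ (1 - α - 1) * s ^ (α + μ + 1 + k * (α + β) - 1) := by
          rw [← intervalIntegral.integral_const_mul]
          refine intervalIntegral.integral_congr_ae (Eventually.of_forall fun s hs => ?_)
          rw [uIoc_of_le ht.le] at hs
          have e3 : α + μ + 1 + k * (α + β) - 1 = (α + μ + 1 - 1) + k * (α + β) := by ring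
          rw [e3, Real.rpow_add hs.1 (α + μ + 1 - 1), hpow s k hs.1]
          ring
      _ = _ := by rw [this]; ring
  simp only [hLk] at hL
  have hL2 := hL.mul_left (Real.Gamma (1 - α))⁻¹
  have eL : (Real.Gamma (1 - α))⁻¹ * ∫ s in (0 : ℝ)..t,
      (t - s) ^ (1 - α - 1) * s ^ (α + μ + 1 - 1) * ∑' k, b k * (s ^ (α + β)) ^ k =
      rlJ (α - 1) (ksSol α β μ lam) t := by
    unfold rlJ
    have : -(α - 1) = 1 - α := by ring
    rw [smul_eq_mul, this]
    congr 1
    refine intervalIntegral.integral_congr_ae (Eventually.of_forall fun s hs => ?_)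
    rw [uIoc_of_le ht.le] at hs
    have e1 : α + μ + 1 - 1 = α + μ := by ring
    have e2 : 1 - α - 1 = -(α - 1 + 1) := by ring
    rw [e1, e2, Real.rpow_neg (by linarith [hs.2]), smul_eq_mul, hexp]
    ring
  rw [eL] at hL2
  -- right-hand side
  have hR := hasSum_integral_mul_rpow_series (g := fun s : ℝ => s ^ (μ + (α + β))) hd ht
    (intervalIntegral.intervalIntegrable_rpow' (by linarith)) hbsum
  have hRk : ∀ k : ℕ, ∫ s in (0 : ℝ)..t, s ^ (μ + (α + β)) * (b k * (s ^ (α + β)) ^ k) =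
      b k * (t ^ (μ + 1 + (k + 1) * (α + β)) / (μ + 1 + (k + 1) * (α + β))) := by
    intro k
    have hk : 0 ≤ k * (α + β) := by positivity
    have hi := integral_rpow (a := 0) (b := t) (r := μ + (k + 1) * (α + β))
      (Or.inl (by linarith))
    have e1 : μ + (k + 1) * (α + β) + 1 = μ + 1 + (k + 1) * (α + β) := by ring
    rw [e1, Real.zero_rpow (by linarith), sub_zero] at hi
    rw [← hi, ← intervalIntegral.integral_const_mul]
    refine intervalIntegral.integral_congr_ae (Eventually.of_forall fun s hs => ?_)
    rw [uIoc_of_le ht.le] at hs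
    have e3 : μ + (k + 1) * (α + β) = (μ + (α + β)) + k * (α + β) := by ring
    rw [e3, Real.rpow_add hs.1 (μ + (α + β)), hpow s k hs.1]
    ring
  simp only [hRk] at hR
  have eR : ∫ s in (0 : ℝ)..t, s ^ (μ + (α + β)) * ∑' k, b k * (s ^ (α + β)) ^ k =
      ∫ s in (0 : ℝ)..t, s ^ β * ksSol α β μ lam s := by
    refine intervalIntegral.integral_congr_ae (Eventually.of_forall fun s hs => ?_)
    rw [uIoc_of_le ht.le] at hs
    have e : μ + (α + β) = β + (α + μ) := by ring
    rw [hexp, e, Real.rpow_add hs.1]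
    ring
  rw [eR] at hR
  -- The zeroth term on the left is t^(μ+1)/Γ(μ+2). By the recurrence for the coefficients, term k+1
  -- on the left is -λ times term k on the right.
  rw [← hL2.tsum_eq, hL2.summable.tsum_eq_zero_add, ← hR.tsum_eq,
    sub_eq_add_neg (t ^ (μ + 1) / _),
    ← tsum_mul_left, ← tsum_neg]
  congr 1
  · simp only [hb, ksCoeff_zero]
    simp
    field_simp
  · congr 1
    ext k
    have hx : 0 < μ + 1 + (k + 1) * (α + β) := by
      have : 0 < (k + 1) * (α + β) := mul_pos (by positivity) hd
      linarith
    have hg1 := (Real.Gamma_pos_of_pos hx).ne'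
    have hg2 := (Real.Gamma_pos_of_pos (show 0 < μ + 1 + (k + 1) * (α + β) + α by linarith)).ne'
    simp only [hb, ksCoeff_succ hα0]
    push_cast
    have e1 : μ + 2 + (k + 1) * (α + β) = μ + 1 + (k + 1) * (α + β) + 1 := by ring
    have e2 : α + μ + 1 + (k + 1) * (α + β) = μ + 1 + (k + 1) * (α + β) + α := by ring
    rw [e1, e2, Real.Gamma_add_one hx.ne']
    generalize μ + 1 + (k + 1) * (α + β) = x at *
    rw [pow_succ]
    field_simp

/-- The constant (μ+1)/Γ(μ+2) is 1/Γ(μ+1) for μ > -1 and vanishes for μ = -1, so this form covers a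
source t^μ as well as a pure initial datum. -/
lemma hasDerivAt_rlJ_ksSol (lam : ℝ) {t : ℝ} (ht : 0 < t) :
    HasDerivAt (rlJ (α - 1) (ksSol α β μ lam))
      ((μ + 1) / Real.Gamma (μ + 2) * t ^ μ - lam * (t ^ β * ksSol α β μ lam t)) t := by
  have h1 : HasDerivAt (fun s : ℝ => s ^ (μ + 1) / Real.Gamma (μ + 2))
      ((μ + 1) / Real.Gamma (μ + 2) * t ^ μ) t := by
    have := (Real.hasDerivAt_rpow_const (x := t) (p := μ + 1) (Or.inl ht.ne')).div_const
      (Real.Gamma (μ + 2))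
    have e : μ + 1 - 1 = μ := by ring
    rw [e] at this
    refine this.congr_deriv ?_
    ring
  have hc : ContinuousOn (fun s => s ^ β * ksSol α β μ lam s) (Ioi 0) := by
    refine ContinuousOn.mul ?_ (continuousOn_ksSol hα0 hα1 hβ hμ lam)
    exact fun s hs => (Real.continuousAt_rpow_const _ _ (Or.inl (ne_of_gt hs))).continuousWithinAt
  have h2 : HasDerivAt (fun r => ∫ s in (0 : ℝ)..r, s ^ β * ksSol α β μ lam s)
      (t ^ β * ksSol α β μ lam t) t :=
    intervalIntegral.integral_hasDerivAt_right
      (intervalIntegrable_rpow_mul_ksSol hα0 hα1 hβ hμ lam ht)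
      (hc.stronglyMeasurableAtFilter isOpen_Ioi t ht)
      (hc.continuousAt (Ioi_mem_nhds ht))
  refine (h1.sub (h2.const_mul lam)).congr_of_eventuallyEq ?_
  filter_upwards [Ioi_mem_nhds ht] with s hs
  exact rlJ_ksSol hα0 hα1 hβ hμ lam hs

end

/-! ### An extremum principle for the Riemann–Liouville derivative -/

/-- The Riemann–Liouville derivative is nonpositive at a minimum with value zero. -/
lemma rlJ_hasDerivAt_nonpos {α : ℝ} (hα0 : 0 < α) (hα1 : α < 1) {y : ℝ → ℝ} {t₀ w : ℝ} (ht₀ : 0 < t₀)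
    (hint : ∀ t, 0 < t → IntervalIntegrable (fun s => ((t - s) ^ (α - 1 + 1))⁻¹ • y s) volume 0 t)
    (hy : ∀ s ∈ Ioo 0 t₀, 0 ≤ y s) (hy0 : y t₀ = 0) (hd : DifferentiableAt ℝ y t₀)
    (hw : HasDerivAt (rlJ (α - 1) y) w t₀) : w ≤ 0 := by
  -- Since y is differentiable at its zero t₀, |y(s)| ≤ C|s - t₀| nearby. This compensates the
  -- singularity of the kernel.
  obtain ⟨C, hC, hCb⟩ := hd.hasDerivAt.isBigO_sub.exists_pos
  rw [Asymptotics.IsBigOWith] at hCb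
  obtain ⟨ε, hε, hball⟩ := Metric.eventually_nhds_iff.1 hCb
  have hG : 0 < Real.Gamma (-(α - 1)) := Real.Gamma_pos_of_pos (by linarith)
  have e1 : α - 1 + 1 = α := by ring
  have hs := (hasDerivWithinAt_iff_tendsto_slope' (s := Iio t₀) (by simp)).1
    (hw.hasDerivWithinAt (s := Iio t₀))
  -- The left difference quotient at t₀ will be bounded by this quantity, which tends to zero
  -- because α < 1.
  have hz : Tendsto (fun t => (Real.Gamma (-(α - 1)))⁻¹ * (C * (t₀ - t) ^ (1 - α))) (𝓝[<] t₀)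
      (𝓝 0) := by
    have hc : Continuous fun t : ℝ => (Real.Gamma (-(α - 1)))⁻¹ * (C * (t₀ - t) ^ (1 - α)) := by
      have : Continuous fun t : ℝ => (t₀ - t) ^ (1 - α) :=
        (Real.continuous_rpow_const (by linarith)).comp (by fun_prop)
      fun_prop
    have := (hc.tendsto t₀).mono_left (nhdsWithin_le_nhds (s := Iio t₀))
    simpa [Real.zero_rpow (show 1 - α ≠ 0 by linarith)] using this
  refine le_of_tendsto_of_tendsto hs hz ?_
  have hnear : Ioo (max 0 (t₀ - ε)) t₀ ∈ 𝓝[<] t₀ :=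
    Ioo_mem_nhdsLT (max_lt ht₀ (by linarith))
  filter_upwards [hnear] with t ht
  have ht0 : 0 < t := (le_max_left _ _).trans_lt ht.1
  have htε : t₀ - ε < t := (le_max_right _ _).trans_lt ht.1
  have htt := ht.2
  have hi0 := hint t₀ ht₀
  have hi := hint t ht0
  rw [e1] at hi0 hi
  have hiA : IntervalIntegrable (fun s => ((t₀ - s) ^ α)⁻¹ • y s) volume 0 t :=
    hi0.mono_set (by rw [uIcc_of_le ht0.le, uIcc_of_le ht₀.le]; exact Icc_subset_Icc_right htt.le)
  have hiB : IntervalIntegrable (fun s => ((t₀ - s) ^ α)⁻¹ • y s) volume t t₀ :=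
    hi0.mono_set (by rw [uIcc_of_le htt.le, uIcc_of_le ht₀.le]; exact Icc_subset_Icc_left ht0.le)
  -- Moving the end point from t to t₀ lowers the kernel, and y ≥ 0. So only the integral over (t,
  -- t₀) can make J^(α-1) y grow.
  have h1 : ∫ s in (0 : ℝ)..t, ((t₀ - s) ^ α)⁻¹ • y s ≤ ∫ s in (0 : ℝ)..t, ((t - s) ^ α)⁻¹ • y s := by
    refine intervalIntegral.integral_mono_on_of_le_Ioo ht0.le hiA hi fun s hs => ?_
    have hts : 0 < t - s := by linarith [hs.2]
    have : (t - s) ^ α ≤ (t₀ - s) ^ α := Real.rpow_le_rpow hts.le (by linarith) hα0.le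
    have h2 : ((t₀ - s) ^ α)⁻¹ ≤ ((t - s) ^ α)⁻¹ :=
      inv_anti₀ (Real.rpow_pos_of_pos hts _) this
    exact mul_le_mul_of_nonneg_right h2 (hy s ⟨hs.1, hs.2.trans htt⟩)
  have h2 : ‖∫ s in t..t₀, ((t₀ - s) ^ α)⁻¹ • y s‖ ≤ C * (t₀ - t) ^ (1 - α) * |t₀ - t| := by
    refine intervalIntegral.norm_integral_le_of_norm_le_const fun s hs => ?_
    rw [uIoc_of_le htt.le] at hs
    rcases eq_or_lt_of_le hs.2 with rfl | hs2
    · rw [hy0]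
      simp only [smul_zero, norm_zero]
      have : 0 ≤ (s - t) ^ (1 - α) := Real.rpow_nonneg (by linarith) _
      positivity
    · have hb := hball (y := s) (by rw [Real.dist_eq, abs_lt]; constructor <;> linarith [hs.1])
      rw [hy0, sub_zero, Real.norm_eq_abs, Real.norm_eq_abs] at hb
      have hp : 0 < t₀ - s := by linarith
      rw [abs_sub_comm, abs_of_pos hp] at hb
      rw [norm_smul, norm_inv, Real.norm_of_nonneg (Real.rpow_nonneg hp.le _), Real.norm_eq_abs]
      calc ((t₀ - s) ^ α)⁻¹ * |y s| ≤ ((t₀ - s) ^ α)⁻¹ * (C * (t₀ - s)) := by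
            gcongr
        _ = C * (t₀ - s) ^ (1 - α) := by
            rw [Real.rpow_sub hp, Real.rpow_one]; ring
        _ ≤ C * (t₀ - t) ^ (1 - α) := by
            have : (t₀ - s) ^ (1 - α) ≤ (t₀ - t) ^ (1 - α) :=
              Real.rpow_le_rpow hp.le (by linarith [hs.1]) (by linarith)
            gcongr
  have hpos : 0 < t₀ - t := by linarith
  have key : rlJ (α - 1) y t₀ - rlJ (α - 1) y t ≤
      (Real.Gamma (-(α - 1)))⁻¹ * (C * (t₀ - t) ^ (1 - α) * (t₀ - t)) := by
    unfold rlJ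
    rw [e1, smul_eq_mul, smul_eq_mul, ← mul_sub,
      ← intervalIntegral.integral_add_adjacent_intervals hiA hiB]
    rw [abs_of_pos hpos] at h2
    have h3 := (le_abs_self _).trans h2
    exact mul_le_mul_of_nonneg_left (by linarith) (inv_nonneg.2 hG.le)
  rw [slope_def_field, ← neg_div_neg_eq, neg_sub, neg_sub, div_le_iff₀ hpos]
  linarith

/-- A continuous function that is positive near `0` and has no first zero is positive. -/
lemma pos_of_no_first_zero {y : ℝ → ℝ} (hc : ContinuousOn y (Ioi 0))
    (h0 : ∀ᶠ t in 𝓝[>] (0 : ℝ), 0 < y t)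
    (h : ∀ t₀, 0 < t₀ → (∀ s ∈ Ioo 0 t₀, 0 < y s) → y t₀ = 0 → False) {t : ℝ} (ht : 0 < t) :
    0 < y t := by
  by_contra hneg
  push Not at hneg
  obtain ⟨ε, hε, hεp⟩ := mem_nhdsGT_iff_exists_Ioo_subset.1 h0
  have hε0 : 0 < ε := hε
  -- Since y > 0 on (0, ε), the bound ε ≤ s loses no nonpositive value and makes the set closed, so
  -- its infimum is attained; it will be the first zero.
  set S : Set ℝ := {s | ε ≤ s ∧ y s ≤ 0} with hS
  have hmemS : ∀ s, 0 < s → y s ≤ 0 → s ∈ S := by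
    intro s hs hy
    refine ⟨?_, hy⟩
    by_contra hlt
    push Not at hlt
    exact absurd (hεp ⟨hs, hlt⟩) (not_lt.2 hy)
  have hne : S.Nonempty := ⟨t, hmemS t ht hneg⟩
  have hbdd : BddBelow S := ⟨ε, fun s hs => hs.1⟩
  have hclosed : IsClosed S := by
    have hcI : ContinuousOn y (Ici ε) := hc.mono fun s hs => lt_of_lt_of_le hε0 hs
    exact hcI.preimage_isClosed_of_isClosed isClosed_Ici isClosed_Iic
  have hmem := hclosed.csInf_mem hne hbdd
  set t₀ := sInf S
  have ht₀ : 0 < t₀ := hε0.trans_le hmem.1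
  have hpos : ∀ s ∈ Ioo 0 t₀, 0 < y s := by
    intro s hs
    by_contra hle
    push Not at hle
    exact absurd (csInf_le hbdd (hmemS s hs.1 hle)) (not_le.2 hs.2)
  refine h t₀ ht₀ hpos (le_antisymm hmem.2 ?_)
  have hca : Tendsto y (𝓝[<] t₀) (𝓝 (y t₀)) :=
    (hc.continuousAt (Ioi_mem_nhds ht₀)).tendsto.mono_left nhdsWithin_le_nhds
  refine ge_of_tendsto hca ?_
  filter_upwards [Ioo_mem_nhdsLT ht₀] with s hs using (hpos s hs).le

/-! ### Bounds for the Kilbas–Saigo functions on the negative half-line -/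

lemma ksSol_zero (α β μ t : ℝ) :
    ksSol α β μ 0 t = t ^ (α + μ) / Real.Gamma (α + μ + 1) := by
  simp [ksSol, ksFun_zero]

/-- A combination of three solutions, the last of which belongs to the parameter `0`. -/
def ksComb (α β μ a b c l₁ l₂ t : ℝ) : ℝ :=
  a * ksSol α β μ l₁ t + b * ksSol α β μ l₂ t + c * ksSol α β μ 0 t

section
variable {α β μ : ℝ} (hα0 : 0 < α) (hα1 : α < 1) (hβ : -α < β) (hμ : -1 ≤ μ)
include hα0 hα1 hβ hμ

lemma differentiableAt_ksComb (a b c l₁ l₂ : ℝ) {t : ℝ} (ht : 0 < t) :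
    DifferentiableAt ℝ (ksComb α β μ a b c l₁ l₂) t :=
  (((differentiableAt_ksSol hα0 hα1 hβ hμ l₁ ht).const_mul a).add
    ((differentiableAt_ksSol hα0 hα1 hβ hμ l₂ ht).const_mul b)).add
    ((differentiableAt_ksSol hα0 hα1 hβ hμ 0 ht).const_mul c)

lemma intervalIntegrable_kernel_mul_ksComb (a b c l₁ l₂ : ℝ) {t : ℝ} (ht : 0 < t) :
    IntervalIntegrable (fun s => ((t - s) ^ (α - 1 + 1))⁻¹ • ksComb α β μ a b c l₁ l₂ s)
      volume 0 t := by
  refine ((((intervalIntegrable_kernel_mul_ksSol hα0 hα1 hβ hμ l₁ ht).const_mul a).add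
    ((intervalIntegrable_kernel_mul_ksSol hα0 hα1 hβ hμ l₂ ht).const_mul b)).add
    ((intervalIntegrable_kernel_mul_ksSol hα0 hα1 hβ hμ 0 ht).const_mul c)).congr fun s _ => ?_
  simp only [ksComb, smul_eq_mul]
  ring

lemma hasDerivAt_rlJ_ksComb (a b c l₁ l₂ : ℝ) {t : ℝ} (ht : 0 < t) :
    HasDerivAt (rlJ (α - 1) (ksComb α β μ a b c l₁ l₂))
      ((a + b + c) * ((μ + 1) / Real.Gamma (μ + 2)) * t ^ μ -
        t ^ β * (a * l₁ * ksSol α β μ l₁ t + b * l₂ * ksSol α β μ l₂ t)) t := by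
  have h := (((hasDerivAt_rlJ_ksSol hα0 hα1 hβ hμ l₁ ht).const_mul a).add
    ((hasDerivAt_rlJ_ksSol hα0 hα1 hβ hμ l₂ ht).const_mul b)).add
    ((hasDerivAt_rlJ_ksSol hα0 hα1 hβ hμ 0 ht).const_mul c)
  refine (h.congr_of_eventuallyEq ?_).congr_deriv (by ring)
  filter_upwards [Ioi_mem_nhds ht] with r hr
  have i1 := (intervalIntegrable_kernel_mul_ksSol hα0 hα1 hβ hμ l₁ hr).const_mul a
  have i2 := (intervalIntegrable_kernel_mul_ksSol hα0 hα1 hβ hμ l₂ hr).const_mul b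
  have i3 := (intervalIntegrable_kernel_mul_ksSol hα0 hα1 hβ hμ 0 hr).const_mul c
  have e : ∫ s in (0 : ℝ)..r, ((r - s) ^ (α - 1 + 1))⁻¹ • ksComb α β μ a b c l₁ l₂ s =
      a * (∫ s in (0 : ℝ)..r, ((r - s) ^ (α - 1 + 1))⁻¹ • ksSol α β μ l₁ s) +
      b * (∫ s in (0 : ℝ)..r, ((r - s) ^ (α - 1 + 1))⁻¹ • ksSol α β μ l₂ s) +
      c * (∫ s in (0 : ℝ)..r, ((r - s) ^ (α - 1 + 1))⁻¹ • ksSol α β μ 0 s) := by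
    rw [← intervalIntegral.integral_const_mul, ← intervalIntegral.integral_const_mul,
      ← intervalIntegral.integral_const_mul, ← intervalIntegral.integral_add i1 i2,
      ← intervalIntegral.integral_add (i1.add i2) i3]
    refine intervalIntegral.integral_congr fun s _ => ?_
    simp only [ksComb, smul_eq_mul]
    ring
  simp only [Pi.add_apply, rlJ, smul_eq_mul] at e ⊢
  rw [e]
  ring

lemma ksComb_eventually_pos {a b c : ℝ} (habc : 0 < a + b + c) (l₁ l₂ : ℝ) :
    ∀ᶠ t in 𝓝[>] (0 : ℝ), 0 < ksComb α β μ a b c l₁ l₂ t := by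
  have hd : 0 < α + β := by linarith
  have hG : 0 < Real.Gamma (α + μ + 1) := Real.Gamma_pos_of_pos (by linarith)
  have hc : Continuous fun s : ℝ => a * ksFun α β μ (-l₁ * s ^ (α + β)) +
      b * ksFun α β μ (-l₂ * s ^ (α + β)) + c * ksFun α β μ (-0 * s ^ (α + β)) :=
    ((continuous_const.mul (continuous_ksFun_comp hα0 hα1 hβ hμ l₁)).add
      (continuous_const.mul (continuous_ksFun_comp hα0 hα1 hβ hμ l₂))).add
      (continuous_const.mul (continuous_ksFun_comp hα0 hα1 hβ hμ 0))
  have h0 := (hc.tendsto 0).mono_left (nhdsWithin_le_nhds (s := Ioi 0))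
  rw [Real.zero_rpow hd.ne'] at h0
  simp only [mul_zero, ksFun_zero, mul_one] at h0
  filter_upwards [h0.eventually (lt_mem_nhds habc), self_mem_nhdsWithin] with t ht ht0
  have hp : 0 < t ^ (α + μ) / Real.Gamma (α + μ + 1) := div_pos (Real.rpow_pos_of_pos ht0 _) hG
  have := mul_pos hp ht
  simp only [ksComb, ksSol]
  linarith

/-- Near 0 the combination behaves like (a+b+c) t^(α+μ)/Γ(α+μ+1). At a first zero the hypothesis
would make the fractional derivative strictly positive, against the extremum principle. -/
lemma ksComb_pos {a b c : ℝ} (habc : 0 < a + b + c) (l₁ l₂ : ℝ)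
    (h : ∀ t, 0 < t → ksComb α β μ a b c l₁ l₂ t = 0 →
      a * l₁ * ksSol α β μ l₁ t + b * l₂ * ksSol α β μ l₂ t < 0) {t : ℝ} (ht : 0 < t) :
    0 < ksComb α β μ a b c l₁ l₂ t := by
  refine pos_of_no_first_zero (fun s hs =>
    (differentiableAt_ksComb hα0 hα1 hβ hμ a b c l₁ l₂ hs).continuousAt.continuousWithinAt)
    (ksComb_eventually_pos hα0 hα1 hβ hμ habc l₁ l₂) (fun t₀ ht₀ hpos hz => ?_) ht
  have h1 := rlJ_hasDerivAt_nonpos hα0 hα1 ht₀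
    (fun t ht => intervalIntegrable_kernel_mul_ksComb hα0 hα1 hβ hμ a b c l₁ l₂ ht)
    (fun s hs => (hpos s hs).le) hz (differentiableAt_ksComb hα0 hα1 hβ hμ a b c l₁ l₂ ht₀)
    (hasDerivAt_rlJ_ksComb hα0 hα1 hβ hμ a b c l₁ l₂ ht₀)
  have h2 := mul_neg_of_pos_of_neg (Real.rpow_pos_of_pos ht₀ β) (h t₀ ht₀ hz)
  have hG : 0 < Real.Gamma (μ + 2) := Real.Gamma_pos_of_pos (by linarith)
  have h3 : 0 ≤ (a + b + c) * ((μ + 1) / Real.Gamma (μ + 2)) * t₀ ^ μ :=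
    mul_nonneg (mul_nonneg habc.le (div_nonneg (by linarith) hG.le)) (Real.rpow_nonneg ht₀.le _)
  linarith

omit hα1 hβ in
lemma ksSol_zero_pos {t : ℝ} (ht : 0 < t) : 0 < ksSol α β μ 0 t := by
  rw [ksSol_zero]
  exact div_pos (Real.rpow_pos_of_pos ht _) (Real.Gamma_pos_of_pos (by linarith))

/-- Adding η times the positive solution for λ = 0 makes the sign at a zero strict: there y = -η y₀
< 0, so λy < 0. Then η is arbitrary. -/
lemma ksSol_nonneg {lam : ℝ} (hlam : 0 < lam) {t : ℝ} (ht : 0 < t) : 0 ≤ ksSol α β μ lam t := by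
  have hS := ksSol_zero_pos (β := β) hα0 hμ ht
  have key : ∀ η, 0 < η → 0 < ksSol α β μ lam t + η * ksSol α β μ 0 t := by
    intro η hη
    have := ksComb_pos hα0 hα1 hβ hμ (a := 1) (b := 0) (c := η) (by linarith) lam 0 ?_ ht
    · simpa [ksComb] using this
    · intro s hs hz
      have hp := mul_pos hη (ksSol_zero_pos (β := β) hα0 hμ hs)
      simp only [ksComb, one_mul, zero_mul, add_zero] at hz ⊢
      exact mul_neg_of_pos_of_neg hlam (by linarith)
  by_contra hneg
  push Not at hneg
  -- This η makes the perturbed value exactly zero, contradicting its positivity.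
  have := key (-ksSol α β μ lam t / ksSol α β μ 0 t) (div_pos (by linarith) hS)
  rw [div_mul_cancel₀ _ hS.ne'] at this
  linarith

/-- At a zero of y₁ - y₂ + ηy₀ one has l₁y₁ - l₂y₂ = -(l₂-l₁)y₂ - l₁ηy₀ < 0, by the nonnegativity of
y₂. -/
lemma ksSol_antitone {l₁ l₂ : ℝ} (h1 : 0 < l₁) (h2 : l₁ < l₂) {t : ℝ} (ht : 0 < t) :
    ksSol α β μ l₂ t ≤ ksSol α β μ l₁ t := by
  have hS := ksSol_zero_pos (β := β) hα0 hμ ht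
  have key : ∀ η, 0 < η → 0 < ksSol α β μ l₁ t - ksSol α β μ l₂ t + η * ksSol α β μ 0 t := by
    intro η hη
    have := ksComb_pos hα0 hα1 hβ hμ (a := 1) (b := -1) (c := η) (by linarith) l₁ l₂ ?_ ht
    · simpa [ksComb, sub_eq_add_neg] using this
    · intro s hs hz
      have hp := mul_pos h1 (mul_pos hη (ksSol_zero_pos (β := β) hα0 hμ hs))
      have hq := mul_nonneg (sub_pos.2 h2).le
        (ksSol_nonneg hα0 hα1 hβ hμ (h1.trans h2) hs)
      have hz' : ksSol α β μ l₁ s = ksSol α β μ l₂ s - η * ksSol α β μ 0 s := by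
        simp only [ksComb] at hz; linarith
      rw [hz']
      linarith
  by_contra hneg
  push Not at hneg
  have := key ((ksSol α β μ l₂ t - ksSol α β μ l₁ t) / ksSol α β μ 0 t)
    (div_pos (by linarith) hS)
  rw [div_mul_cancel₀ _ hS.ne'] at this
  linarith

lemma ksFun_neg_nonneg {x : ℝ} (hx : 0 < x) : 0 ≤ ksFun α β μ (-x) := by
  have h := ksSol_nonneg hα0 hα1 hβ hμ hx one_pos
  simp only [ksSol, Real.one_rpow, mul_one] at h
  exact nonneg_of_mul_nonneg_right h
    (one_div_pos.2 (Real.Gamma_pos_of_pos (by linarith)))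

lemma ksFun_neg_antitone {x y : ℝ} (hx : 0 < x) (hxy : x ≤ y) :
    ksFun α β μ (-y) ≤ ksFun α β μ (-x) := by
  rcases eq_or_lt_of_le hxy with rfl | hlt
  · exact le_rfl
  have h := ksSol_antitone hα0 hα1 hβ hμ hx hlt one_pos
  simp only [ksSol, Real.one_rpow, mul_one] at h
  exact le_of_mul_le_mul_left h (one_div_pos.2 (Real.Gamma_pos_of_pos (by linarith)))

lemma ksFun_neg_le_one {x : ℝ} (hx : 0 < x) : ksFun α β μ (-x) ≤ 1 := by
  have hc : Continuous fun y : ℝ => ksFun α β μ (-y) :=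
    (differentiable_ksFun hα0 hα1 hβ hμ).continuous.comp continuous_neg
  have h0 := (hc.tendsto 0).mono_left (nhdsWithin_le_nhds (s := Ioi 0))
  rw [neg_zero, ksFun_zero] at h0
  refine ge_of_tendsto h0 ?_
  filter_upwards [Ioc_mem_nhdsGT hx] with y hy
  exact ksFun_neg_antitone hα0 hα1 hβ hμ hy.1 hy.2

omit hα0 hα1 hμ in
lemma exists_rpow_eq {x : ℝ} (hx : 0 < x) : ∃ t : ℝ, 0 < t ∧ t ^ (α + β) = x := by
  have hd : α + β ≠ 0 := by linarith
  exact ⟨x ^ (α + β)⁻¹, Real.rpow_pos_of_pos hx _, Real.rpow_inv_rpow hx.le hd⟩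

/-- The lower bound `1 ≤ E(-x) (1 + Γ(μ+1) / Γ(α+μ+1) x)`, in a form that allows `μ = -1`. -/
lemma ksFun_neg_lower {x : ℝ} (hx : 0 < x) :
    (μ + 1) / Real.Gamma (μ + 2) ≤
      ksFun α β μ (-x) * ((μ + 1) / Real.Gamma (μ + 2) + x / Real.Gamma (α + μ + 1)) := by
  obtain ⟨t, ht, rfl⟩ := exists_rpow_eq hβ hx
  have hd : 0 < α + β := by linarith
  have hG : 0 < Real.Gamma (α + μ + 1) := Real.Gamma_pos_of_pos (by linarith)
  set e := ksFun α β μ (-t ^ (α + β)) with he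
  have hform : ∀ s, ksComb α β μ 1 0 (-e) 1 0 s =
      s ^ (α + μ) / Real.Gamma (α + μ + 1) * (ksFun α β μ (-s ^ (α + β)) - e) := by
    intro s
    simp only [ksComb, ksSol_zero]
    simp only [ksSol, neg_one_mul]
    ring
  -- By monotonicity of E, the combination y₁ - e y₀ (parameters 1 and 0) is nonnegative before t
  -- and zero at t. The sign of its fractional derivative at t is the claimed bound up to a factor
  -- t^μ.
  have h1 := rlJ_hasDerivAt_nonpos hα0 hα1 ht
    (fun t ht => intervalIntegrable_kernel_mul_ksComb hα0 hα1 hβ hμ 1 0 (-e) 1 0 ht)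
    (fun s hs => by
      rw [hform]
      refine mul_nonneg (div_nonneg (Real.rpow_nonneg hs.1.le _) hG.le) (sub_nonneg.2 ?_)
      exact ksFun_neg_antitone hα0 hα1 hβ hμ (Real.rpow_pos_of_pos hs.1 _)
        (Real.rpow_le_rpow hs.1.le hs.2.le hd.le))
    (by rw [hform, he]; ring) (differentiableAt_ksComb hα0 hα1 hβ hμ 1 0 (-e) 1 0 ht)
    (hasDerivAt_rlJ_ksComb hα0 hα1 hβ hμ 1 0 (-e) 1 0 ht)
  simp only [ksSol, neg_one_mul, ← he] at h1
  have e2 : t ^ (α + μ) * t ^ β = t ^ μ * t ^ (α + β) := by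
    rw [← Real.rpow_add ht, ← Real.rpow_add ht]; ring_nf
  have h3 : t ^ μ * ((1 - e) * ((μ + 1) / Real.Gamma (μ + 2)) -
      t ^ (α + β) / Real.Gamma (α + μ + 1) * e) ≤ 0 := by
    have : t ^ μ * ((1 - e) * ((μ + 1) / Real.Gamma (μ + 2)) -
      t ^ (α + β) / Real.Gamma (α + μ + 1) * e) =
      t ^ μ * ((1 - e) * ((μ + 1) / Real.Gamma (μ + 2))) -
      (t ^ μ * t ^ (α + β)) / Real.Gamma (α + μ + 1) * e := by ring
    rw [this, ← e2]
    refine le_of_eq_of_le ?_ h1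
    ring
  have h4 := nonpos_of_mul_nonpos_right h3 (Real.rpow_pos_of_pos ht μ)
  linarith

/-- Since y ≥ 0, also J^(α-1) y ≥ 0, so the integrated equation with λ = 1 gives ∫₀ᵗ s^β y ≤
t^(μ+1)/Γ(μ+2). Replacing E(-s^(α+β)) by its smallest value, at s = t, bounds the integral from
below. -/
lemma mul_ksFun_neg_le {x : ℝ} (hx : 0 < x) :
    x * ksFun α β μ (-x) ≤
      (μ + 1 + (α + β)) * Real.Gamma (α + μ + 1) / Real.Gamma (μ + 2) := by
  obtain ⟨t, ht, rfl⟩ := exists_rpow_eq hβ hx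
  have hd : 0 < α + β := by linarith
  have hG : 0 < Real.Gamma (α + μ + 1) := Real.Gamma_pos_of_pos (by linarith)
  have hG2 : 0 < Real.Gamma (μ + 2) := Real.Gamma_pos_of_pos (by linarith)
  set e := ksFun α β μ (-t ^ (α + β)) with he
  have h1 : 0 ≤ rlJ (α - 1) (ksSol α β μ 1) t := by
    unfold rlJ
    refine mul_nonneg (inv_nonneg.2 (Real.Gamma_pos_of_pos (by linarith)).le) ?_
    refine intervalIntegral.integral_nonneg_of_ae_restrict ht.le ?_
    refine (ae_restrict_iff' measurableSet_Icc).2 ?_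
    have h0 : ∀ᵐ s : ℝ, s ≠ 0 := by simp [ae_iff]
    filter_upwards [h0] with s hs0 hs
    exact mul_nonneg (inv_nonneg.2 (Real.rpow_nonneg (by linarith [hs.2]) _))
      (ksSol_nonneg hα0 hα1 hβ hμ one_pos (lt_of_le_of_ne hs.1 hs0.symm))
  rw [rlJ_ksSol hα0 hα1 hβ hμ 1 ht, one_mul] at h1
  have hi := integral_rpow (a := 0) (b := t) (r := μ + (α + β)) (Or.inl (by linarith))
  have hi' : IntervalIntegrable (fun s : ℝ => s ^ (μ + (α + β))) volume 0 t :=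
    intervalIntegral.intervalIntegrable_rpow' (by linarith)
  rw [Real.zero_rpow (by linarith), sub_zero] at hi
  have h2 : e / Real.Gamma (α + μ + 1) * ∫ s in (0 : ℝ)..t, s ^ (μ + (α + β)) ≤
      ∫ s in (0 : ℝ)..t, s ^ β * ksSol α β μ 1 s := by
    rw [← intervalIntegral.integral_const_mul]
    refine intervalIntegral.integral_mono_on_of_le_Ioo ht.le (hi'.const_mul _)
      (intervalIntegrable_rpow_mul_ksSol hα0 hα1 hβ hμ 1 ht) fun s hs => ?_
    have e3 : μ + (α + β) = β + (α + μ) := by ring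
    have hanti : e ≤ ksFun α β μ (-s ^ (α + β)) :=
      ksFun_neg_antitone hα0 hα1 hβ hμ (Real.rpow_pos_of_pos hs.1 _)
        (Real.rpow_le_rpow hs.1.le hs.2.le hd.le)
    have hp : 0 ≤ s ^ β * s ^ (α + μ) / Real.Gamma (α + μ + 1) :=
      div_nonneg (mul_nonneg (Real.rpow_nonneg hs.1.le _) (Real.rpow_nonneg hs.1.le _)) hG.le
    have := mul_le_mul_of_nonneg_left hanti hp
    rw [e3, Real.rpow_add hs.1 β]
    simp only [ksSol, neg_one_mul]
    calc _ = s ^ β * s ^ (α + μ) / Real.Gamma (α + μ + 1) * e := by ring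
      _ ≤ _ := this
      _ = _ := by ring
  rw [hi] at h2
  have h3 := h2.trans (sub_nonneg.1 h1)
  have e4 : μ + (α + β) + 1 = (μ + 1) + (α + β) := by ring
  rw [e4, Real.rpow_add ht] at h3
  have hp1 := Real.rpow_pos_of_pos ht (μ + 1)
  have hm : 0 < μ + 1 + (α + β) := by linarith
  rw [le_div_iff₀ hG2]
  have e5 : e / Real.Gamma (α + μ + 1) * (t ^ (μ + 1) * t ^ (α + β) / (μ + 1 + (α + β))) =
      t ^ (μ + 1) * (t ^ (α + β) * e) / (Real.Gamma (α + μ + 1) * (μ + 1 + (α + β))) := by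
    field_simp
  rw [e5, div_le_div_iff₀ (mul_pos hG hm) hG2] at h3
  have h6 : t ^ (μ + 1) * (t ^ (α + β) * e * Real.Gamma (μ + 2)) ≤
      t ^ (μ + 1) * ((μ + 1 + (α + β)) * Real.Gamma (α + μ + 1)) := by linarith
  exact le_of_mul_le_mul_left h6 hp1

end

/-! ### Abel inversion -/

lemma intervalIntegrable_sub_rpow {p t : ℝ} (hp : 0 < p) :
    IntervalIntegrable (fun s : ℝ => (t - s) ^ (p - 1)) volume 0 t := by
  have h : IntervalIntegrable (fun x : ℝ => x ^ (p - 1)) volume 0 t :=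
    intervalIntegral.intervalIntegrable_rpow' (by linarith)
  simpa using (h.comp_sub_left t).symm

lemma integral_sub_rpow {p t : ℝ} (hp : 0 < p) :
    ∫ s in (0 : ℝ)..t, (t - s) ^ (p - 1) = t ^ p / p := by
  rw [intervalIntegral.integral_comp_sub_left (fun x : ℝ => x ^ (p - 1)) t, sub_self, sub_zero,
    integral_rpow (Or.inl (by linarith)), sub_add_cancel, Real.zero_rpow hp.ne', sub_zero]

/-- The kernel of the composition of two fractional integrals. -/
def abelKernel (α t s r : ℝ) : ℝ :=
  (Ioi r).indicator (fun s => (t - s) ^ (α - 1) * (s - r) ^ (-α)) s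

lemma abelKernel_nonneg {α t s r : ℝ} (hst : s ≤ t) : 0 ≤ abelKernel α t s r := by
  unfold abelKernel
  by_cases h : s ∈ Ioi r
  · rw [indicator_of_mem h]
    have : r < s := h
    exact mul_nonneg (Real.rpow_nonneg (by linarith) _) (Real.rpow_nonneg (by linarith) _)
  · rw [indicator_of_notMem h]

/-- After a shift by r this is the Beta integral B(1-α, α). Its independence of r and t is what
makes Abel inversion work. -/
lemma abelKernel_section {α t r : ℝ} (hα0 : 0 < α) (hα1 : α < 1) (hr : 0 ≤ r) (hrt : r < t) :
    IntegrableOn (fun s => abelKernel α t s r) (Ioc 0 t) ∧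
      ∫ s in Ioc 0 t, abelKernel α t s r = Real.Gamma α * Real.Gamma (1 - α) := by
  have htr : 0 < t - r := by linarith
  have hi := intervalIntegrable_beta (p := 1 - α) (q := α) (by linarith) hα0 htr
  have hv := integral_beta (p := 1 - α) (q := α) (by linarith) hα0 htr
  have e1 : 1 - α - 1 = -α := by ring
  have e2 : 1 - α + α = 1 := by ring
  rw [e1] at hi hv
  rw [e2, sub_self, Real.rpow_zero, one_mul, Real.Gamma_one, div_one] at hv
  have hi' : IntervalIntegrable (fun s => (t - s) ^ (α - 1) * (s - r) ^ (-α)) volume r t := by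
    have := hi.comp_sub_right r
    simpa using this
  have hv' : ∫ s in r..t, (t - s) ^ (α - 1) * (s - r) ^ (-α) =
      Real.Gamma α * Real.Gamma (1 - α) := by
    have := intervalIntegral.integral_comp_sub_right (a := r) (b := t)
      (fun x : ℝ => (t - r - x) ^ (α - 1) * x ^ (-α)) r
    rw [sub_self, hv] at this
    simpa [mul_comm] using this
  have hset : Ioc 0 t ∩ Ioi r = Ioc r t := by
    ext x
    simp only [mem_inter_iff, mem_Ioc, mem_Ioi]
    constructor
    · rintro ⟨⟨_, h2⟩, h3⟩; exact ⟨h3, h2⟩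
    · rintro ⟨h1, h2⟩; exact ⟨⟨hr.trans_lt h1, h2⟩, h1⟩
  unfold abelKernel
  constructor
  · rw [integrableOn_indicator_iff measurableSet_Ioi, inter_comm, hset]
    exact (intervalIntegrable_iff_integrableOn_Ioc_of_le hrt.le).1 hi'
  · rw [setIntegral_indicator measurableSet_Ioi, hset, ← intervalIntegral.integral_of_le hrt.le]
    exact hv'

lemma measurable_abelKernel (α t : ℝ) :
    Measurable fun p : ℝ × ℝ => abelKernel α t p.1 p.2 := by
  have : (fun p : ℝ × ℝ => abelKernel α t p.1 p.2) =
      {p : ℝ × ℝ | p.2 < p.1}.indicator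
        (fun p => (t - p.1) ^ (α - 1) * (p.1 - p.2) ^ (-α)) := by
    ext p
    by_cases h : p.2 < p.1
    · rw [indicator_of_mem (show p ∈ {p : ℝ × ℝ | p.2 < p.1} from h), abelKernel,
        indicator_of_mem (show p.1 ∈ Ioi p.2 from h)]
    · rw [indicator_of_notMem (show p ∉ {p : ℝ × ℝ | p.2 < p.1} from h), abelKernel,
        indicator_of_notMem (show p.1 ∉ Ioi p.2 from h)]
  rw [this]
  refine Measurable.indicator (by fun_prop) ?_
  exact measurableSet_lt measurable_snd measurable_fst

section
variable {E : Type*} [NormedAddCommGroup E] [NormedSpace ℝ E]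

/-- Fubini on the triangle r < s ≤ t: integrating out s leaves the constant Γ(α)Γ(1-α). -/
lemma integral_rlJ_eq [CompleteSpace E] {α t : ℝ} (hα0 : 0 < α) (hα1 : α < 1) (ht : 0 < t)
    {z : ℝ → E} (hz : IntervalIntegrable z volume 0 t) :
    ∫ s in (0 : ℝ)..t, (t - s) ^ (α - 1) • rlJ (α - 1) z s =
      Real.Gamma α • ∫ s in (0 : ℝ)..t, z s := by
  have hG : Real.Gamma (1 - α) ≠ 0 := (Real.Gamma_pos_of_pos (by linarith)).ne'
  have hz' : IntegrableOn z (Ioc 0 t) := (intervalIntegrable_iff_integrableOn_Ioc_of_le ht.le).1 hz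
  set ν : Measure ℝ := volume.restrict (Ioc 0 t) with hν
  have hmeas : AEStronglyMeasurable (fun p : ℝ × ℝ => abelKernel α t p.1 p.2 • z p.2)
      (ν.prod ν) :=
    (measurable_abelKernel α t).aestronglyMeasurable.smul hz'.aestronglyMeasurable.comp_snd
  have hae : ∀ᵐ r ∂ν, r ∈ Ioo 0 t := by
    have h1 : ∀ᵐ r ∂ν, r ∈ Ioc 0 t := ae_restrict_mem measurableSet_Ioc
    have h2 : ∀ᵐ r ∂ν, r ≠ t := ae_restrict_of_ae (by simp [ae_iff])
    filter_upwards [h1, h2] with r hr1 hr2 using ⟨hr1.1, lt_of_le_of_ne hr1.2 hr2⟩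
  have hsec : ∀ r ∈ Ioo 0 t, ∫ s, ‖abelKernel α t s r • z r‖ ∂ν =
      Real.Gamma α * Real.Gamma (1 - α) * ‖z r‖ := by
    intro r hr
    rw [← (abelKernel_section hα0 hα1 hr.1.le hr.2).2, ← integral_mul_const]
    refine setIntegral_congr_fun measurableSet_Ioc fun s hs => ?_
    simp only [norm_smul, Real.norm_of_nonneg (abelKernel_nonneg (r := r) (α := α) hs.2)]
  have hint : Integrable (fun p : ℝ × ℝ => abelKernel α t p.1 p.2 • z p.2) (ν.prod ν) := by
    rw [integrable_prod_iff' hmeas]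
    constructor
    · filter_upwards [hae] with r hr
      exact (abelKernel_section hα0 hα1 hr.1.le hr.2).1.smul_const (z r)
    · refine Integrable.congr (hz'.norm.const_mul (Real.Gamma α * Real.Gamma (1 - α))) ?_
      filter_upwards [hae] with r hr
      exact (hsec r hr).symm
  have hswap := integral_integral_swap (f := fun s r => abelKernel α t s r • z r) hint
  have hR : ∫ r, ∫ s, abelKernel α t s r • z r ∂ν ∂ν =
      (Real.Gamma α * Real.Gamma (1 - α)) • ∫ s in (0 : ℝ)..t, z s := by
    rw [intervalIntegral.integral_of_le ht.le, ← integral_smul]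
    refine integral_congr_ae ?_
    filter_upwards [hae] with r hr
    rw [integral_smul_const, (abelKernel_section hα0 hα1 hr.1.le hr.2).2]
  have hL : ∫ s, ∫ r, abelKernel α t s r • z r ∂ν ∂ν =
      Real.Gamma (1 - α) • ∫ s in (0 : ℝ)..t, (t - s) ^ (α - 1) • rlJ (α - 1) z s := by
    rw [intervalIntegral.integral_of_le ht.le, ← integral_smul]
    refine setIntegral_congr_fun measurableSet_Ioc fun s hs => ?_
    have e1 : (fun r => abelKernel α t s r • z r) =
        (Iio s).indicator fun r => (t - s) ^ (α - 1) • ((s - r) ^ (α - 1 + 1))⁻¹ • z r := by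
      ext r
      by_cases h : r < s
      · rw [indicator_of_mem (show r ∈ Iio s from h), abelKernel,
          indicator_of_mem (show s ∈ Ioi r from h), mul_smul, sub_add_cancel,
          Real.rpow_neg (by linarith)]
      · rw [indicator_of_notMem (show r ∉ Iio s from h), abelKernel,
          indicator_of_notMem (show s ∉ Ioi r from h), zero_smul]
    have e2 : Ioc 0 t ∩ Iio s = Ioo 0 s := by
      ext x
      simp only [mem_inter_iff, mem_Ioc, mem_Iio, mem_Ioo]
      constructor
      · rintro ⟨⟨h1, _⟩, h3⟩; exact ⟨h1, h3⟩
      · rintro ⟨h1, h2⟩; exact ⟨⟨h1, h2.le.trans hs.2⟩, h2⟩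
    have e3 : -(α - 1) = 1 - α := by ring
    simp only [e1, hν]
    rw [setIntegral_indicator measurableSet_Iio, e2, integral_smul, rlJ,
      intervalIntegral.integral_of_le hs.1.le, integral_Ioc_eq_integral_Ioo, smul_comm,
      e3, smul_inv_smul₀ hG]
  rw [hL, hR, mul_comm, mul_smul] at hswap
  exact smul_right_injective _ hG hswap

/-! ### Uniqueness for the scalar equation -/

/-- By exp(-x) ≤ x^(-η) with x = σ(t-s), a slightly stronger kernel singularity buys the factor
σ^(-η), which is small for large σ. -/
lemma norm_integral_kernel_le {α η σ M t : ℝ} (hη0 : 0 ≤ η) (hη1 : η ≤ 1) (hηα : η < α)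
    (hσ : 0 < σ) (hM : 0 ≤ M) (ht : 0 < t) {w : ℝ → E}
    (hw : ∀ s ∈ Ioo 0 t, ‖w s‖ ≤ M * Real.exp (σ * s)) :
    ‖∫ s in (0 : ℝ)..t, (t - s) ^ (α - 1) • w s‖ ≤
      M * Real.exp (σ * t) * σ ^ (-η) * (t ^ (α - η) / (α - η)) := by
  have hp : 0 < α - η := by linarith
  rw [← integral_sub_rpow hp, ← intervalIntegral.integral_const_mul]
  refine intervalIntegral.norm_integral_le_of_norm_le ht.le ?_
    ((intervalIntegrable_sub_rpow hp).const_mul _)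
  have h0 : ∀ᵐ s : ℝ, s ≠ t := by simp [ae_iff]
  filter_upwards [h0] with s hst hs
  have hts : 0 < t - s := sub_pos.2 (lt_of_le_of_ne hs.2 hst)
  have hx : 0 < σ * (t - s) := mul_pos hσ hts
  have hexp : Real.exp (-(σ * (t - s))) ≤ (σ * (t - s)) ^ (-η) := by
    rw [Real.exp_neg, Real.rpow_neg hx.le]
    refine inv_anti₀ (Real.rpow_pos_of_pos hx _) ?_
    have h1 := Real.add_one_le_exp (σ * (t - s))
    rcases le_total (σ * (t - s)) 1 with h | h
    · exact (Real.rpow_le_one hx.le h hη0).trans (by linarith)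
    · calc (σ * (t - s)) ^ η ≤ (σ * (t - s)) ^ (1 : ℝ) := Real.rpow_le_rpow_of_exponent_le h hη1
        _ ≤ _ := by rw [Real.rpow_one]; linarith
  rw [norm_smul, Real.norm_of_nonneg (Real.rpow_nonneg hts.le _)]
  have e1 : Real.exp (σ * s) = Real.exp (σ * t) * Real.exp (-(σ * (t - s))) := by
    rw [← Real.exp_add]; ring_nf
  have e2 : (t - s) ^ (α - η - 1) = (t - s) ^ (α - 1) * (t - s) ^ (-η) := by
    rw [← Real.rpow_add hts]; ring_nf
  calc (t - s) ^ (α - 1) * ‖w s‖ ≤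
        (t - s) ^ (α - 1) * (M * (Real.exp (σ * t) * (σ * (t - s)) ^ (-η))) := by
        refine mul_le_mul_of_nonneg_left ?_ (Real.rpow_nonneg hts.le _)
        refine (hw s ⟨hs.1, by linarith⟩).trans ?_
        rw [e1]
        gcongr
    _ = _ := by rw [Real.mul_rpow hσ.le hts.le, e2]; ring

variable {α β lam T : ℝ} {z : ℝ → E}

lemma intervalIntegrable_of_kernel (hα0 : 0 < α) (hT : 0 < T)
    (hint : IntervalIntegrable (fun s => ((T - s) ^ (α - 1 + 1))⁻¹ • z s) volume 0 T) :
    IntervalIntegrable z volume 0 T := by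
  rw [sub_add_cancel] at hint
  have hc : Continuous fun s : ℝ => (T - s) ^ α :=
    (Real.continuous_rpow_const hα0.le).comp (by fun_prop)
  refine (hint.continuousOn_smul hc.continuousOn).congr_ae ?_
  have h0 : ∀ᵐ s : ℝ ∂volume.restrict (uIoc 0 T), s ≠ T := ae_restrict_of_ae (by simp [ae_iff])
  filter_upwards [h0, ae_restrict_mem measurableSet_uIoc] with s hst hs
  rw [uIoc_of_le hT.le] at hs
  have : 0 < T - s := sub_pos.2 (lt_of_le_of_ne hs.2 hst)
  exact smul_inv_smul₀ (Real.rpow_pos_of_pos this _).ne' _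

/-- The homogeneous scalar equation in integrated form. -/
lemma rlJ_eq_of_homogeneous [CompleteSpace E] (hα0 : 0 < α) (hα1 : α < 1) (hβ : -α < β)
    (hzc : ContinuousOn z (Ioo 0 T))
    (hzi : IntervalIntegrable z volume 0 T) {M : ℝ} (hM : 0 ≤ M)
    (hbd : ∀ t ∈ Ioo 0 T, ‖rlJ (α - 1) z t‖ ≤ M)
    (h0 : Tendsto (rlJ (α - 1) z) (𝓝[>] 0) (𝓝 0))
    (hder : ∀ t ∈ Ioo 0 T, HasDerivAt (rlJ (α - 1) z) (-((lam * t ^ β) • z t)) t)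
    {t : ℝ} (ht : t ∈ Ioo 0 T) :
    IntervalIntegrable (fun s => s ^ (β - 1) • ∫ r in (0 : ℝ)..s, z r) volume 0 t ∧
    rlJ (α - 1) z t = -((lam * t ^ β) • ∫ s in (0 : ℝ)..t, z s) +
      (lam * β) • ∫ s in (0 : ℝ)..t, s ^ (β - 1) • ∫ r in (0 : ℝ)..s, z r := by
  have hd : 0 < α + β := by linarith
  have hG : 0 < Real.Gamma α := Real.Gamma_pos_of_pos hα0
  have hT : 0 < T := ht.1.trans ht.2
  set Z : ℝ → E := fun s => ∫ r in (0 : ℝ)..s, z r with hZ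
  have hzi' : ∀ s ∈ Ioo 0 T, IntervalIntegrable z volume 0 s := fun s hs =>
    hzi.mono_set (by
      rw [uIcc_of_le hs.1.le, uIcc_of_le hT.le]; exact Icc_subset_Icc_right hs.2.le)
  have hZd : ∀ s ∈ Ioo 0 T, HasDerivAt Z (z s) s := fun s hs =>
    intervalIntegral.integral_hasDerivAt_right (hzi' s hs)
      (hzc.stronglyMeasurableAtFilter isOpen_Ioo s hs) (hzc.continuousAt (isOpen_Ioo.mem_nhds hs))
  -- Abel inversion of the bounded function w = J^(α-1) z. Only the order s^α matters, so η = 0 and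
  -- σ = 1 suffice.
  obtain ⟨C, hC0, hC⟩ : ∃ C, 0 ≤ C ∧ ∀ s ∈ Ioo 0 T, ‖Z s‖ ≤ C * s ^ α := by
    refine ⟨M * Real.exp T / α / Real.Gamma α, by positivity, fun s hs => ?_⟩
    have h1 := integral_rlJ_eq hα0 hα1 hs.1 (hzi' s hs)
    have h2 := norm_integral_kernel_le (η := 0) (σ := 1) (w := rlJ (α - 1) z) le_rfl zero_le_one
      hα0 one_pos hM hs.1 (fun r hr => (hbd r ⟨hr.1, hr.2.trans hs.2⟩).trans
        (le_mul_of_one_le_right hM (Real.one_le_exp (by linarith [hr.1]))))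
    rw [h1, norm_smul, Real.norm_of_nonneg hG.le, neg_zero, Real.rpow_zero, mul_one, sub_zero,
      one_mul] at h2
    have h3 : Real.exp s ≤ Real.exp T := Real.exp_le_exp.2 hs.2.le
    have hs' := Real.rpow_pos_of_pos hs.1 α
    have h4 : Real.Gamma α * ‖Z s‖ ≤ M * Real.exp T * (s ^ α / α) :=
      h2.trans (by gcongr)
    calc ‖Z s‖ ≤ M * Real.exp T * (s ^ α / α) / Real.Gamma α := by
          rw [le_div_iff₀ hG]; linarith
      _ = _ := by ring
  have hrc : ∀ p : ℝ, ContinuousOn (fun s : ℝ => s ^ p) (Ioo 0 T) := fun p s hs =>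
    (Real.continuousAt_rpow_const _ _ (Or.inl hs.1.ne')).continuousWithinAt
  have hZc : ContinuousOn Z (Ioo 0 T) := fun s hs => (hZd s hs).continuousAt.continuousWithinAt
  have hfc : ContinuousOn (fun s => s ^ (β - 1) • Z s) (Ioo 0 T) := (hrc _).smul hZc
  have hfb : ∀ s ∈ Ioo 0 T, ‖s ^ (β - 1) • Z s‖ ≤ C * s ^ (α + β - 1) := by
    intro s hs
    rw [norm_smul, Real.norm_of_nonneg (Real.rpow_nonneg hs.1.le _)]
    have e : α + β - 1 = (β - 1) + α := by ring
    rw [e, Real.rpow_add hs.1]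
    calc _ ≤ s ^ (β - 1) * (C * s ^ α) :=
          mul_le_mul_of_nonneg_left (hC s hs) (Real.rpow_nonneg hs.1.le _)
      _ = _ := by ring
  have hpi : ∀ s : ℝ, IntervalIntegrable (fun s : ℝ => C * s ^ (α + β - 1)) volume 0 s := fun s =>
    (intervalIntegral.intervalIntegrable_rpow' (by linarith)).const_mul C
  have hfi : ∀ s ∈ Ioo 0 T, IntervalIntegrable (fun s => s ^ (β - 1) • Z s) volume 0 s := by
    intro s hs
    refine (hpi s).mono_fun ?_ ?_
    · rw [uIoc_of_le hs.1.le]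
      exact (hfc.mono fun r hr => ⟨hr.1, hr.2.trans_lt hs.2⟩).aestronglyMeasurable
        measurableSet_Ioc
    · refine (ae_restrict_iff' measurableSet_uIoc).2 (Eventually.of_forall fun r hr => ?_)
      rw [uIoc_of_le hs.1.le] at hr
      exact (hfb r ⟨hr.1, hr.2.trans_lt hs.2⟩).trans (le_abs_self _)
  refine ⟨hfi t ht, ?_⟩
  -- This is w' = -λt^β z integrated by parts: s^β z is not known to be integrable at 0, whereas
  -- s^(β-1) Z is of order s^(α+β-1).
  set G : ℝ → E := fun t => rlJ (α - 1) z t + (lam * t ^ β) • Z t -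
    (lam * β) • ∫ s in (0 : ℝ)..t, s ^ (β - 1) • Z s with hGdef
  have hGd : ∀ s ∈ Ioo 0 T, HasDerivAt G 0 s := by
    intro s hs
    have d1 := hder s hs
    have d2 : HasDerivAt (fun s : ℝ => lam * s ^ β) (lam * (β * s ^ (β - 1))) s :=
      (Real.hasDerivAt_rpow_const (Or.inl hs.1.ne')).const_mul lam
    have d3 := d2.smul (hZd s hs)
    have d4 : HasDerivAt (fun t => ∫ s in (0 : ℝ)..t, s ^ (β - 1) • Z s) (s ^ (β - 1) • Z s) s :=
      intervalIntegral.integral_hasDerivAt_right (hfi s hs)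
        (hfc.stronglyMeasurableAtFilter isOpen_Ioo s hs)
        (hfc.continuousAt (isOpen_Ioo.mem_nhds hs))
    refine ((d1.add d3).sub (d4.const_smul (lam * β))).congr_deriv ?_
    rw [smul_smul]
    have : lam * (β * s ^ (β - 1)) = lam * β * s ^ (β - 1) := by ring
    rw [this]
    abel
  have hlim : Tendsto G (𝓝[>] 0) (𝓝 0) := by
    have hIoo : Ioo 0 T ∈ 𝓝[>] (0 : ℝ) := Ioo_mem_nhdsGT hT
    have hpow : Tendsto (fun s : ℝ => s ^ (α + β)) (𝓝[>] 0) (𝓝 0) := by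
      have := ((Real.continuous_rpow_const hd.le).tendsto (0 : ℝ)).mono_left
        (nhdsWithin_le_nhds (s := Ioi 0))
      rwa [Real.zero_rpow hd.ne'] at this
    have l2 : Tendsto (fun s : ℝ => (lam * s ^ β) • Z s) (𝓝[>] 0) (𝓝 0) := by
      refine squeeze_zero_norm' (a := fun s => |lam| * C * s ^ (α + β)) ?_
        (by simpa using hpow.const_mul (|lam| * C))
      filter_upwards [hIoo] with s hs
      have hsβ := Real.rpow_pos_of_pos hs.1 β
      rw [norm_smul, norm_mul, Real.norm_eq_abs, Real.norm_of_nonneg hsβ.le, Real.rpow_add hs.1]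
      calc |lam| * s ^ β * ‖Z s‖ ≤ |lam| * s ^ β * (C * s ^ α) :=
            mul_le_mul_of_nonneg_left (hC s hs) (by positivity)
        _ = _ := by ring
    have l3 : Tendsto (fun t => ∫ s in (0 : ℝ)..t, s ^ (β - 1) • Z s) (𝓝[>] 0) (𝓝 0) := by
      refine squeeze_zero_norm' (a := fun s => C / (α + β) * s ^ (α + β)) ?_
        (by simpa using hpow.const_mul (C / (α + β)))
      filter_upwards [hIoo] with s hs
      have hi := integral_rpow (a := 0) (b := s) (r := α + β - 1) (Or.inl (by linarith))
      rw [sub_add_cancel, Real.zero_rpow hd.ne', sub_zero] at hi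
      have e : C / (α + β) * s ^ (α + β) = ∫ r in (0 : ℝ)..s, C * r ^ (α + β - 1) := by
        rw [intervalIntegral.integral_const_mul, hi]; ring
      rw [e]
      refine intervalIntegral.norm_integral_le_of_norm_le hs.1.le
        (Eventually.of_forall fun r hr => hfb r ⟨hr.1, hr.2.trans_lt hs.2⟩) (hpi s)
    simpa using (h0.add l2).sub (l3.const_smul (lam * β))
  have hconst : ∀ s ∈ Ioo 0 T, G s = G t := fun s hs =>
    isOpen_Ioo.is_const_of_deriv_eq_zero isPreconnected_Ioo
      (fun r hr => (hGd r hr).differentiableAt.differentiableWithinAt)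
      (fun r hr => (hGd r hr).deriv) hs ht
  have hGt : G t = 0 := by
    refine tendsto_nhds_unique (tendsto_const_nhds.congr' ?_) hlim
    filter_upwards [Ioo_mem_nhdsGT hT] with s hs using (hconst s hs).symm
  have : rlJ (α - 1) z t + (lam * t ^ β) • Z t -
    (lam * β) • ∫ s in (0 : ℝ)..t, s ^ (β - 1) • Z s = 0 := hGt
  rw [sub_eq_zero, ← eq_sub_iff_add_eq] at this
  rw [this]
  abel

/-- The homogeneous scalar equation `w' + λ t^β z = 0`, `w = J^(α-1) z`, `w(0+) = 0`, has only the
zero solution. -/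
lemma eq_zero_of_homogeneous [CompleteSpace E] (hα0 : 0 < α) (hα1 : α < 1) (hβ : -α < β)
    (hlam : 0 < lam) (hT : 0 < T) (hzc : ContinuousOn z (Ioo 0 T))
    (hint : IntervalIntegrable (fun s => ((T - s) ^ (α - 1 + 1))⁻¹ • z s) volume 0 T)
    (hwc : ContinuousOn (rlJ (α - 1) z) (Ioc 0 T))
    (h0 : Tendsto (rlJ (α - 1) z) (𝓝[>] 0) (𝓝 0))
    (hder : ∀ t ∈ Ioo 0 T, HasDerivAt (rlJ (α - 1) z) (-((lam * t ^ β) • z t)) t) :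
    ∀ t ∈ Ioo 0 T, z t = 0 := by
  have hd : 0 < α + β := by linarith
  have hG : 0 < Real.Gamma α := Real.Gamma_pos_of_pos hα0
  have hzi := intervalIntegrable_of_kernel hα0 hT hint
  set w := rlJ (α - 1) z with hw
  -- The integral over an empty interval is zero, which agrees with the limit at 0+. Hence w is
  -- continuous on all of [0, T].
  have hw0 : w 0 = 0 := by simp [hw, rlJ]
  have hwc' : ContinuousOn w (Icc 0 T) := by
    intro s hs
    rcases eq_or_lt_of_le hs.1 with rfl | hs0
    · have : ContinuousWithinAt w (Ioi 0) 0 := by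
        rw [ContinuousWithinAt, hw0]; exact h0
      exact (continuousWithinAt_Ioi_iff_Ici.1 this).mono Icc_subset_Ici_self
    · have h1 := hwc s ⟨hs0, hs.2⟩
      refine h1.mono_of_mem_nhdsWithin ?_
      have h2 : Ioi 0 ∩ Icc 0 T ∈ 𝓝[Icc 0 T] s :=
        inter_mem (mem_nhdsWithin_of_mem_nhds (Ioi_mem_nhds hs0)) self_mem_nhdsWithin
      exact mem_of_superset h2 fun r hr => ⟨hr.1, hr.2.2⟩
  obtain ⟨M₀, hM₀⟩ := isCompact_Icc.exists_bound_of_continuousOn hwc'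
  have hM₀0 : 0 ≤ M₀ := (norm_nonneg _).trans (hM₀ 0 ⟨le_rfl, hT.le⟩)
  have hrep := fun t (ht : t ∈ Ioo 0 T) => rlJ_eq_of_homogeneous hα0 hα1 hβ hzc hzi hM₀0
    (fun t ht => hM₀ t ⟨ht.1.le, ht.2.le⟩) h0 hder ht
  obtain ⟨η, hη0, hη1, hηα, hηd⟩ : ∃ η, 0 < η ∧ η ≤ 1 ∧ η < α ∧ η < α + β := by
    refine ⟨min α (α + β) / 2, ?_, ?_, ?_, ?_⟩
    · have := lt_min hα0 hd; linarith
    · have := min_le_left α (α + β); linarith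
    · have := min_le_left α (α + β); linarith
    · have := min_le_right α (α + β)
      have := lt_min hα0 hd; linarith
  have hp1 : 0 < α - η := by linarith
  have hp2 : 0 < α + β - η := by linarith
  set D := 1 / ((α - η) * Real.Gamma α) with hD
  have hD0 : 0 < D := by positivity
  -- K collects the constants of the two terms in the representation of w, with Z estimated through
  -- Abel inversion. A large σ then makes the map a contraction with factor 1/2.
  set K := lam * D * T ^ (α + β - η) * (1 + |β| / (α + β - η)) with hK
  obtain ⟨σ, hσ0, hσ⟩ : ∃ σ : ℝ, 0 < σ ∧ σ ^ (-η) * K ≤ 1 / 2 := by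
    have h1 : Tendsto (fun σ : ℝ => σ ^ (-η) * K) atTop (𝓝 0) := by
      simpa using (tendsto_rpow_neg_atTop hη0).mul_const K
    obtain ⟨σ, h2, h3⟩ := ((h1.eventually (ge_mem_nhds (by norm_num : (0 : ℝ) < 1 / 2))).and
      (eventually_gt_atTop 0)).exists
    exact ⟨σ, h3, h2⟩
  have hw_zero : ∀ t ∈ Ioo 0 T, w t = 0 := by
    intro t₁ ht₁
    -- The weighted norm M of w on [0, t₁] is attained at s. The representation of w(s) will give M
    -- ≤ M/2.
    obtain ⟨s, hs, hmax⟩ := (isCompact_Icc (a := (0 : ℝ)) (b := t₁)).exists_isMaxOn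
      (f := fun r => Real.exp (-(σ * r)) * ‖w r‖) ⟨0, le_rfl, ht₁.1.le⟩
      (ContinuousOn.mul (by fun_prop) (hwc'.mono (Icc_subset_Icc_right ht₁.2.le)).norm)
    set M := Real.exp (-(σ * s)) * ‖w s‖ with hMdef
    have hM0 : 0 ≤ M := by positivity
    have hwM : ∀ r ∈ Icc 0 t₁, ‖w r‖ ≤ M * Real.exp (σ * r) := by
      intro r hr
      have h1 : Real.exp (-(σ * r)) * ‖w r‖ ≤ M := hmax hr
      rw [Real.exp_neg, inv_mul_le_iff₀ (Real.exp_pos _)] at h1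
      linarith
    have hMz : M = 0 := by
      rcases eq_or_lt_of_le hs.1 with hs0 | hs0
      · rw [hMdef, ← hs0, hw0]; simp
      have hsT : s ∈ Ioo 0 T := ⟨hs0, hs.2.trans_lt ht₁.2⟩
      have hZb : ∀ r ∈ Ioc 0 s, ‖∫ x in (0 : ℝ)..r, z x‖ ≤
          M * Real.exp (σ * s) * σ ^ (-η) * D * r ^ (α - η) := by
        intro r hr
        have hzr : IntervalIntegrable z volume 0 r := hzi.mono_set (by
          rw [uIcc_of_le hr.1.le, uIcc_of_le hT.le]
          exact Icc_subset_Icc_right (hr.2.trans hsT.2.le))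
        have h1 := integral_rlJ_eq hα0 hα1 hr.1 hzr
        have h2 := norm_integral_kernel_le (w := w) hη0.le hη1 hηα hσ0 hM0 hr.1
          (fun x hx => hwM x ⟨hx.1.le, hx.2.le.trans (hr.2.trans hs.2)⟩)
        rw [h1, norm_smul, Real.norm_of_nonneg hG.le] at h2
        have h3 : Real.exp (σ * r) ≤ Real.exp (σ * s) :=
          Real.exp_le_exp.2 (mul_le_mul_of_nonneg_left hr.2 hσ0.le)
        have hr1 := Real.rpow_pos_of_pos hr.1 (α - η)
        have hσ1 := Real.rpow_pos_of_pos hσ0 (-η)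
        have h4 : Real.Gamma α * ‖∫ x in (0 : ℝ)..r, z x‖ ≤
          M * Real.exp (σ * s) * σ ^ (-η) * (r ^ (α - η) / (α - η)) := h2.trans (by gcongr)
        calc _ ≤ M * Real.exp (σ * s) * σ ^ (-η) * (r ^ (α - η) / (α - η)) / Real.Gamma α := by
              rw [le_div_iff₀ hG]; linarith
          _ = _ := by rw [hD]; field_simp
      obtain ⟨hfi, hws⟩ := hrep s hsT
      set B := M * Real.exp (σ * s) * σ ^ (-η) * D with hB
      have hσ1 := Real.rpow_pos_of_pos hσ0 (-η)
      have hB0 : 0 ≤ B := by positivity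
      have hsp := Real.rpow_pos_of_pos hs0 (α + β - η)
      have b1 : ‖(lam * s ^ β) • ∫ x in (0 : ℝ)..s, z x‖ ≤ lam * B * s ^ (α + β - η) := by
        have hsβ := Real.rpow_pos_of_pos hs0 β
        rw [norm_smul, Real.norm_of_nonneg (by positivity)]
        have e : α + β - η = β + (α - η) := by ring
        rw [e, Real.rpow_add hs0]
        calc _ ≤ lam * s ^ β * (B * s ^ (α - η)) :=
              mul_le_mul_of_nonneg_left (hZb s ⟨hs0, le_rfl⟩) (by positivity)
          _ = _ := by ring
      have b2 : ‖∫ r in (0 : ℝ)..s, r ^ (β - 1) • ∫ x in (0 : ℝ)..r, z x‖ ≤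
          B * (s ^ (α + β - η) / (α + β - η)) := by
        have hi := integral_rpow (a := 0) (b := s) (r := α + β - η - 1) (Or.inl (by linarith))
        rw [sub_add_cancel, Real.zero_rpow hp2.ne', sub_zero] at hi
        rw [← hi, ← intervalIntegral.integral_const_mul]
        refine intervalIntegral.norm_integral_le_of_norm_le hs0.le
          (Eventually.of_forall fun r hr => ?_)
          ((intervalIntegral.intervalIntegrable_rpow' (by linarith)).const_mul B)
        rw [norm_smul, Real.norm_of_nonneg (Real.rpow_nonneg hr.1.le _)]
        have e : α + β - η - 1 = (β - 1) + (α - η) := by ring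
        rw [e, Real.rpow_add hr.1]
        calc _ ≤ r ^ (β - 1) * (B * r ^ (α - η)) :=
              mul_le_mul_of_nonneg_left (hZb r hr) (Real.rpow_nonneg hr.1.le _)
          _ = _ := by ring
      have hsT' : s ^ (α + β - η) ≤ T ^ (α + β - η) :=
        Real.rpow_le_rpow hs0.le hsT.2.le hp2.le
      have b3 : ‖w s‖ ≤ M * Real.exp (σ * s) * (σ ^ (-η) * K) := by
        rw [hw, hws]
        refine (norm_add_le _ _).trans ?_
        rw [norm_neg, norm_smul (lam * β), norm_mul, Real.norm_of_nonneg hlam.le, Real.norm_eq_abs]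
        calc _ ≤ lam * B * s ^ (α + β - η) +
              lam * |β| * (B * (s ^ (α + β - η) / (α + β - η))) := by gcongr
          _ = lam * B * s ^ (α + β - η) * (1 + |β| / (α + β - η)) := by ring
          _ ≤ lam * B * T ^ (α + β - η) * (1 + |β| / (α + β - η)) := by gcongr
          _ = _ := by rw [hB, hK]; ring
      have b4 : M ≤ M * (1 / 2) := by
        calc M = Real.exp (-(σ * s)) * ‖w s‖ := hMdef
          _ ≤ Real.exp (-(σ * s)) * (M * Real.exp (σ * s) * (σ ^ (-η) * K)) := by gcongr
          _ = M * (σ ^ (-η) * K) := by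
              rw [Real.exp_neg]; field_simp
          _ ≤ M * (1 / 2) := by gcongr
      linarith
    have := hwM t₁ ⟨ht₁.1.le, le_rfl⟩
    rw [hMz, zero_mul] at this
    exact norm_le_zero_iff.1 this
  intro t ht
  have h1 : HasDerivAt w 0 t := by
    refine (hasDerivAt_const t (0 : E)).congr_of_eventuallyEq ?_
    filter_upwards [isOpen_Ioo.mem_nhds ht] with s hs using hw_zero s hs
  have h2 := (hder t ht).unique h1
  rw [neg_eq_zero] at h2
  exact (smul_eq_zero.1 h2).resolve_left (mul_pos hlam (Real.rpow_pos_of_pos ht.1 _)).ne'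

end

/-! ### Fourier series in a Hilbert space -/

/-- A real-linear bounded map commutes with the Riemann–Liouville integral. -/
lemma rlJ_clm {E F : Type*} [NormedAddCommGroup E] [NormedSpace ℝ E] [CompleteSpace E]
    [NormedAddCommGroup F] [NormedSpace ℝ F] [CompleteSpace F] (L : E →L[ℝ] F) {σ t : ℝ}
    {u : ℝ → E}
    (hu : IntervalIntegrable (fun ξ => ((t - ξ) ^ (σ + 1))⁻¹ • u ξ) volume 0 t) :
    rlJ σ (fun s => L (u s)) t = L (rlJ σ u t) := by
  unfold rlJ
  rw [L.map_smul, ← L.intervalIntegral_comp_comm hu]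
  simp only [L.map_smul]

section
variable {𝕜 : Type*} [RCLike 𝕜] {H : Type*} [NormedAddCommGroup H]
  [InnerProductSpace 𝕜 H] (v : HilbertBasis ℕ 𝕜 H)

/-- The sum of the Fourier series with given coefficients. -/
def fourierSum (c : ℕ → 𝕜) : H := ∑' k, c k • v k

variable {v}

lemma hilbertBasis_ext {x y : H} (h : ∀ k, inner 𝕜 (v k) x = (inner 𝕜 (v k) y : 𝕜)) : x = y := by
  apply v.repr.injective
  ext k
  rw [v.repr_apply_apply, v.repr_apply_apply, h k]

lemma hasSum_inner_smul (x : H) : HasSum (fun k => (inner 𝕜 (v k) x : 𝕜) • v k) x := by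
  have := v.hasSum_repr x
  simpa only [v.repr_apply_apply] using this

lemma hasSum_norm_inner_sq (x : H) :
    HasSum (fun k => ‖(inner 𝕜 (v k) x : 𝕜)‖ ^ 2) (‖x‖ ^ 2) := by
  have h := lp.hasSum_norm (p := 2) (by norm_num) (v.repr x)
  simp only [v.repr_apply_apply, v.repr.norm_map] at h
  simpa using h

lemma fourierSum_eq {c : ℕ → 𝕜} (hc : Summable fun k => ‖c k‖ ^ 2) :
    ∃ x : H, fourierSum v c = x ∧ (∀ k, inner 𝕜 (v k) x = c k) := by
  have hm : Memℓp c 2 := (memℓp_gen_iff (by norm_num)).2 (by simpa using hc)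
  refine ⟨v.repr.symm ⟨c, hm⟩, (v.hasSum_repr_symm ⟨c, hm⟩).tsum_eq, fun k => ?_⟩
  rw [← v.repr_apply_apply, v.repr.apply_symm_apply]

lemma inner_fourierSum {c : ℕ → 𝕜} (hc : Summable fun k => ‖c k‖ ^ 2) (k : ℕ) :
    inner 𝕜 (v k) (fourierSum v c) = c k := by
  obtain ⟨x, rfl, h⟩ := fourierSum_eq (v := v) hc
  exact h k

lemma hasSum_norm_sq_fourierSum {c : ℕ → 𝕜} (hc : Summable fun k => ‖c k‖ ^ 2) :
    HasSum (fun k => ‖c k‖ ^ 2) (‖fourierSum v c‖ ^ 2) := by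
  have := hasSum_norm_inner_sq (v := v) (fourierSum v c)
  simpa only [inner_fourierSum hc] using this

lemma summable_sq_of_le {c : ℕ → 𝕜} {b : ℕ → ℝ} {r : ℝ} (hb : Summable fun k => b k ^ 2)
    (h : ∀ k, ‖c k‖ ≤ r * b k) : Summable fun k => ‖c k‖ ^ 2 := by
  refine Summable.of_nonneg_of_le (fun k => by positivity) (fun k => ?_) (hb.mul_left (r ^ 2))
  rw [← mul_pow]
  exact pow_le_pow_left₀ (norm_nonneg _) (h k) 2

lemma norm_fourierSum_le {c : ℕ → 𝕜} {b : ℕ → ℝ} {r : ℝ} (hr : 0 ≤ r)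
    (hb : Summable fun k => b k ^ 2) (h : ∀ k, ‖c k‖ ≤ r * b k) :
    ‖fourierSum v c‖ ≤ r * √(∑' k, b k ^ 2) := by
  have hc := summable_sq_of_le hb h
  have h0 : 0 ≤ ∑' k, b k ^ 2 := tsum_nonneg fun k => by positivity
  refine abs_le_of_sq_le_sq' ?_ (by positivity) |>.2
  rw [mul_pow, Real.sq_sqrt h0, ← (hasSum_norm_sq_fourierSum (v := v) hc).tsum_eq, ← tsum_mul_left]
  refine hc.tsum_le_tsum (fun k => ?_) (hb.mul_left _)
  rw [← mul_pow]
  exact pow_le_pow_left₀ (norm_nonneg _) (h k) 2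

/-- A Fourier series with continuous, locally uniformly dominated coefficients is continuous. -/
lemma continuousOn_fourierSum {S : Set ℝ} {c : ℝ → ℕ → 𝕜} {b : ℕ → ℝ} {r : ℝ → ℝ}
    (hr : ContinuousOn r S) (hb : Summable fun k => b k ^ 2)
    (hbd : ∀ t ∈ S, ∀ k, ‖c t k‖ ≤ r t * b k) (hb0 : ∀ k, 0 ≤ b k)
    (hc : ∀ k, ContinuousOn (fun t => c t k) S) :
    ContinuousOn (fun t => fourierSum v (c t)) S := by
  intro t₀ ht₀
  have hsum : ∀ t ∈ S, Summable fun k => ‖c t k‖ ^ 2 := fun t ht => summable_sq_of_le hb (hbd t ht)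
  have hnear : ∀ᶠ t in 𝓝[S] t₀, r t ≤ r t₀ + 1 :=
    ((hr t₀ ht₀).eventually (gt_mem_nhds (show r t₀ < r t₀ + 1 by linarith))).mono
      fun _ h => h.le
  have hdiff : ∀ᶠ t in 𝓝[S] t₀, ∀ k, ‖c t k - c t₀ k‖ ≤ (2 * r t₀ + 1) * b k := by
    filter_upwards [hnear, self_mem_nhdsWithin] with t ht htS k
    have h1 := hbd t htS k
    have h2 := hbd t₀ ht₀ k
    have h3 := mul_le_mul_of_nonneg_right ht (hb0 k)
    have h4 := norm_sub_le (c t k) (c t₀ k)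
    linarith
  -- By Parseval this sum is the squared distance of the two Fourier sums, so dominated convergence
  -- for series yields continuity.
  have hlim : Tendsto (fun t => ∑' k, ‖c t k - c t₀ k‖ ^ 2) (𝓝[S] t₀) (𝓝 (∑' _ : ℕ, (0 : ℝ))) := by
    refine tendsto_tsum_of_dominated_convergence (bound := fun k => ((2 * r t₀ + 1) * b k) ^ 2)
      ?_ (fun k => ?_) ?_
    · simp only [mul_pow]
      exact hb.mul_left _
    · have h1 := ((hc k t₀ ht₀).sub (continuousWithinAt_const (b := c t₀ k))).norm.pow 2
      simpa [ContinuousWithinAt, Pi.pow_def] using h1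
    · filter_upwards [hdiff] with t ht k
      rw [Real.norm_of_nonneg (by positivity)]
      exact pow_le_pow_left₀ (norm_nonneg _) (ht k) 2
  rw [tsum_zero] at hlim
  have hnorm : Tendsto (fun t => ‖fourierSum v (c t) - fourierSum v (c t₀)‖ ^ 2) (𝓝[S] t₀)
      (𝓝 0) := by
    refine hlim.congr' ?_
    filter_upwards [self_mem_nhdsWithin] with t ht
    rw [← (hasSum_norm_inner_sq (v := v) (fourierSum v (c t) - fourierSum v (c t₀))).tsum_eq]
    refine tsum_congr fun k => ?_
    rw [inner_sub_right, inner_fourierSum (hsum t ht), inner_fourierSum (hsum t₀ ht₀)]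
  rw [ContinuousWithinAt, tendsto_iff_norm_sub_tendsto_zero]
  have := hnorm.sqrt
  simpa using this

/-! ### Diagonal self-adjoint operators -/

variable [CompleteSpace H] {A : H →ₗ.[𝕜] H} {lam : ℕ → ℝ}

lemma inner_apply_of_eigenvector (hA : IsSelfAdjoint A)
    (hv : ∀ k, (v k, (lam k : 𝕜) • v k) ∈ A.graph) (k : ℕ) (x : A.domain) :
    inner 𝕜 (v k) (A x) = (lam k : 𝕜) * inner 𝕜 (v k) (x : H) := by
  obtain ⟨y, hy1, hy2⟩ := (LinearPMap.mem_graph_iff A).1 (hv k)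
  simp only at hy1 hy2
  have hF : A.IsFormalAdjoint A := by
    have := LinearPMap.adjoint_isFormalAdjoint hA.dense_domain
    rwa [LinearPMap.isSelfAdjoint_def.1 hA] at this
  have h := hF y x
  rw [hy1, hy2, inner_smul_left] at h
  rw [← h]
  simp

/-- The pair (x, g) is the limit of finite combinations of the pairs (v_k, λ_k v_k), and the graph
of a self-adjoint operator is closed. -/
lemma mem_domain_of_coeff (hA : IsSelfAdjoint A)
    (hv : ∀ k, (v k, (lam k : 𝕜) • v k) ∈ A.graph) {x g : H}
    (h : ∀ k, inner 𝕜 (v k) g = (lam k : 𝕜) * (inner 𝕜 (v k) x : 𝕜)) :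
    ∃ hx : x ∈ A.domain, A ⟨x, hx⟩ = g := by
  have h1 := hasSum_inner_smul (v := v) x
  have h2 := hasSum_inner_smul (v := v) g
  have h3 := h1.prodMk h2
  have hcl : _root_.IsClosed (A.graph : Set (H × H)) := hA.isClosed
  have hmem : (x, g) ∈ A.graph := by
    refine hcl.mem_of_tendsto h3 (Eventually.of_forall fun s => ?_)
    refine A.graph.sum_mem fun k _ => ?_
    have := A.graph.smul_mem (inner 𝕜 (v k) x : 𝕜) (hv k)
    rw [Prod.smul_mk, smul_smul] at this
    rwa [h k, mul_comm (lam k : 𝕜)]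
  obtain ⟨y, hy1, hy2⟩ := (LinearPMap.mem_graph_iff A).1 hmem
  simp only at hy1 hy2
  subst hy1
  exact ⟨y.2, hy2⟩

end

/-! ### The modes of a solution -/

lemma tendsto_primitive_zero {E : Type*} [NormedAddCommGroup E] [NormedSpace ℝ E] {h : ℝ → E}
    (hi : IntervalIntegrable h volume 0 1) :
    Tendsto (fun t => ∫ s in (0 : ℝ)..t, h s) (𝓝[>] 0) (𝓝 0) := by
  have hc := intervalIntegral.continuousOn_primitive_interval
    ((intervalIntegrable_iff_integrableOn_Icc_of_le zero_le_one).1 hi |>.mono_set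
      (by rw [uIcc_of_le zero_le_one]))
  have h0 := hc 0 (by simp)
  rw [ContinuousWithinAt, intervalIntegral.integral_same, uIcc_of_le zero_le_one] at h0
  refine h0.mono_left ?_
  rw [← nhdsWithin_Ioc_eq_nhdsGT one_pos]
  exact nhdsWithin_mono _ Ioc_subset_Icc_self

section
variable {α β μ : ℝ} (hα0 : 0 < α) (hα1 : α < 1) (hβ : -α < β)
include hα0 hα1 hβ

lemma tendsto_integral_rpow_mul_ksSol (hμ : -1 ≤ μ) (lam : ℝ) :
    Tendsto (fun t => ∫ s in (0 : ℝ)..t, s ^ β * ksSol α β μ lam s) (𝓝[>] 0) (𝓝 0) :=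
  tendsto_primitive_zero (intervalIntegrable_rpow_mul_ksSol hα0 hα1 hβ hμ lam one_pos)

lemma tendsto_rlJ_ksSol (hμ : -1 < μ) (lam : ℝ) :
    Tendsto (rlJ (α - 1) (ksSol α β μ lam)) (𝓝[>] 0) (𝓝 0) := by
  have h1 : Tendsto (fun t : ℝ => t ^ (μ + 1) / Real.Gamma (μ + 2)) (𝓝[>] 0) (𝓝 0) := by
    have hc : Continuous fun t : ℝ => t ^ (μ + 1) / Real.Gamma (μ + 2) :=
      (Real.continuous_rpow_const (by linarith)).div_const _
    have := (hc.tendsto 0).mono_left (nhdsWithin_le_nhds (s := Ioi 0))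
    rwa [Real.zero_rpow (by linarith), zero_div] at this
  have h2 := h1.sub ((tendsto_integral_rpow_mul_ksSol hα0 hα1 hβ hμ.le lam).const_mul lam)
  rw [mul_zero, sub_zero] at h2
  refine h2.congr' ?_
  filter_upwards [self_mem_nhdsWithin] with t ht
  exact (rlJ_ksSol hα0 hα1 hβ hμ.le lam ht).symm

lemma rlJ_ksSol_neg_one (lam : ℝ) {t : ℝ} (ht : 0 < t) :
    rlJ (α - 1) (ksSol α β (-1) lam) t =
      1 - lam * ∫ s in (0 : ℝ)..t, s ^ β * ksSol α β (-1) lam s := by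
  rw [rlJ_ksSol hα0 hα1 hβ le_rfl lam ht]
  have e : (-1 : ℝ) + 2 = 1 := by norm_num
  rw [neg_add_cancel, Real.rpow_zero, e, Real.Gamma_one, div_one]

lemma tendsto_rlJ_ksSol_neg_one (lam : ℝ) :
    Tendsto (rlJ (α - 1) (ksSol α β (-1) lam)) (𝓝[>] 0) (𝓝 1) := by
  have h2 := (tendsto_const_nhds (x := (1 : ℝ))).sub
    ((tendsto_integral_rpow_mul_ksSol hα0 hα1 hβ le_rfl lam).const_mul lam)
  rw [mul_zero, sub_zero] at h2
  refine h2.congr' ?_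
  filter_upwards [self_mem_nhdsWithin] with t ht
  exact (rlJ_ksSol_neg_one hα0 hα1 hβ lam ht).symm

end

/-- The solution of the scalar problem `w' + λ t^β y = t^μ f`, `w = J^(α-1) y`, `w(0+) = φ`. -/
def modeSol {𝕜 : Type*} [RCLike 𝕜] (α β μ lam : ℝ) (φ f : 𝕜) (t : ℝ) : 𝕜 :=
  ksSol α β (-1) lam t • φ + ksSol α β μ lam t • (Real.Gamma (μ + 1) • f)

section
variable {𝕜 : Type*} [RCLike 𝕜] {α β μ : ℝ} (hα0 : 0 < α) (hα1 : α < 1) (hβ : -α < β) (hμ : -1 < μ)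
include hα0 hα1 hβ hμ

lemma continuousOn_modeSol (lam : ℝ) (φ f : 𝕜) :
    ContinuousOn (modeSol α β μ lam φ f) (Ioi 0) :=
  ((continuousOn_ksSol hα0 hα1 hβ le_rfl lam).smul continuousOn_const).add
    ((continuousOn_ksSol hα0 hα1 hβ hμ.le lam).smul continuousOn_const)

omit hα0 hα1 hβ hμ in
lemma intervalIntegrable_smul_const {E : Type*} [NormedAddCommGroup E] [NormedSpace ℝ E]
    {g : ℝ → ℝ} {a b : ℝ} (hg : IntervalIntegrable g volume a b) (c : E) :
    IntervalIntegrable (fun s => g s • c) volume a b :=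
  ⟨hg.1.smul_const c, hg.2.smul_const c⟩

lemma intervalIntegrable_kernel_smul_modeSol (lam : ℝ) (φ f : 𝕜) {t : ℝ} (ht : 0 < t) :
    IntervalIntegrable (fun s => ((t - s) ^ (α - 1 + 1))⁻¹ • modeSol α β μ lam φ f s)
      volume 0 t := by
  refine ((intervalIntegrable_smul_const
    (intervalIntegrable_kernel_mul_ksSol hα0 hα1 hβ le_rfl lam ht) φ).add
    (intervalIntegrable_smul_const (intervalIntegrable_kernel_mul_ksSol hα0 hα1 hβ hμ.le lam ht)
      (Real.Gamma (μ + 1) • f))).congr fun s _ => ?_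
  simp only [modeSol, smul_add, smul_assoc]

lemma rlJ_modeSol (lam : ℝ) (φ f : 𝕜) {t : ℝ} (ht : 0 < t) :
    rlJ (α - 1) (modeSol α β μ lam φ f) t =
      rlJ (α - 1) (ksSol α β (-1) lam) t • φ +
        rlJ (α - 1) (ksSol α β μ lam) t • (Real.Gamma (μ + 1) • f) := by
  have i1 := intervalIntegrable_kernel_mul_ksSol hα0 hα1 hβ le_rfl lam ht
  have i2 := intervalIntegrable_kernel_mul_ksSol hα0 hα1 hβ hμ.le lam ht
  unfold rlJ
  rw [smul_assoc, smul_assoc, ← smul_add, ← intervalIntegral.integral_smul_const,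
    ← intervalIntegral.integral_smul_const,
    ← intervalIntegral.integral_add (intervalIntegrable_smul_const i1 _)
      (intervalIntegrable_smul_const i2 _)]
  simp only [modeSol, smul_add, smul_assoc]

lemma continuousOn_rlJ_modeSol (lam : ℝ) (φ f : 𝕜) :
    ContinuousOn (rlJ (α - 1) (modeSol α β μ lam φ f)) (Ioi 0) := by
  refine ContinuousOn.congr (f := fun t => rlJ (α - 1) (ksSol α β (-1) lam) t • φ +
        rlJ (α - 1) (ksSol α β μ lam) t • (Real.Gamma (μ + 1) • f)) ?_
    fun t ht => rlJ_modeSol hα0 hα1 hβ hμ lam φ f ht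
  intro t ht
  exact (((hasDerivAt_rlJ_ksSol hα0 hα1 hβ le_rfl lam ht).continuousAt.smul
    continuousAt_const).add ((hasDerivAt_rlJ_ksSol hα0 hα1 hβ hμ.le lam ht).continuousAt.smul
    continuousAt_const)).continuousWithinAt

lemma tendsto_rlJ_modeSol (lam : ℝ) (φ f : 𝕜) :
    Tendsto (rlJ (α - 1) (modeSol α β μ lam φ f)) (𝓝[>] 0) (𝓝 φ) := by
  have h := ((tendsto_rlJ_ksSol_neg_one hα0 hα1 hβ lam).smul_const φ).add
    ((tendsto_rlJ_ksSol hα0 hα1 hβ hμ lam).smul_const (Real.Gamma (μ + 1) • f))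
  rw [one_smul, zero_smul, add_zero] at h
  refine h.congr' ?_
  filter_upwards [self_mem_nhdsWithin] with t ht
  exact (rlJ_modeSol hα0 hα1 hβ hμ lam φ f ht).symm

lemma hasDerivAt_rlJ_modeSol (lam : ℝ) (φ f : 𝕜) {t : ℝ} (ht : 0 < t) :
    HasDerivAt (rlJ (α - 1) (modeSol α β μ lam φ f))
      (t ^ μ • f - (lam * t ^ β) • modeSol α β μ lam φ f t) t := by
  have h := ((hasDerivAt_rlJ_ksSol hα0 hα1 hβ le_rfl lam ht).smul_const φ).add
    ((hasDerivAt_rlJ_ksSol hα0 hα1 hβ hμ.le lam ht).smul_const (Real.Gamma (μ + 1) • f))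
  refine (h.congr_of_eventuallyEq ?_).congr_deriv ?_
  · filter_upwards [Ioi_mem_nhds ht] with s hs
    exact rlJ_modeSol hα0 hα1 hβ hμ lam φ f hs
  · have hm : μ + 1 ≠ 0 := by linarith
    have e : μ + 2 = (μ + 1) + 1 := by ring
    have hG : Real.Gamma (μ + 1) ≠ 0 := (Real.Gamma_pos_of_pos (by linarith)).ne'
    have e2 : (μ + 1) / Real.Gamma (μ + 2) * Real.Gamma (μ + 1) = 1 := by
      rw [e, Real.Gamma_add_one hm]; field_simp
    have e3 : t ^ μ • f = ((μ + 1) / Real.Gamma (μ + 2) * t ^ μ) • Real.Gamma (μ + 1) • f := by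
      rw [smul_smul]
      congr 1
      rw [mul_right_comm, e2, one_mul]
    -- For μ = -1 the source coefficient (μ+1)/Γ(μ+2) is zero, so the φ-part contributes no power of
    -- t.
    rw [e3, modeSol, neg_add_cancel, zero_div, zero_mul]
    module

/-- The integrated form passes to the Hilbert space coefficient by coefficient, which avoids
termwise differentiation of the series. -/
lemma rlJ_modeSol_eq (lam : ℝ) (φ f : 𝕜) {t : ℝ} (ht : 0 < t) :
    IntervalIntegrable (fun s : ℝ => s ^ μ • f - (s ^ β * lam) • modeSol α β μ lam φ f s)
      volume 0 t ∧
    rlJ (α - 1) (modeSol α β μ lam φ f) t =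
      φ + ∫ s in (0 : ℝ)..t, (s ^ μ • f - (s ^ β * lam) • modeSol α β μ lam φ f s) := by
  have i1 := intervalIntegrable_smul_const
    (intervalIntegrable_rpow_mul_ksSol hα0 hα1 hβ le_rfl lam ht) (lam • φ)
  have i2 := intervalIntegrable_smul_const
    (intervalIntegrable_rpow_mul_ksSol hα0 hα1 hβ hμ.le lam ht) (lam • Real.Gamma (μ + 1) • f)
  have i3 : IntervalIntegrable (fun s : ℝ => s ^ μ • f) volume 0 t :=
    intervalIntegrable_smul_const (intervalIntegral.intervalIntegrable_rpow' hμ) f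
  have e : (fun s : ℝ => s ^ μ • f - (s ^ β * lam) • modeSol α β μ lam φ f s) =
      fun s => s ^ μ • f - ((s ^ β * ksSol α β (-1) lam s) • lam • φ +
        (s ^ β * ksSol α β μ lam s) • lam • Real.Gamma (μ + 1) • f) := by
    ext s
    rw [modeSol]
    module
  rw [e]
  refine ⟨i3.sub (i1.add i2), ?_⟩
  rw [intervalIntegral.integral_sub i3 (i1.add i2), intervalIntegral.integral_add i1 i2,
    intervalIntegral.integral_smul_const, intervalIntegral.integral_smul_const,
    intervalIntegral.integral_smul_const, rlJ_modeSol hα0 hα1 hβ hμ lam φ f ht,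
    rlJ_ksSol_neg_one hα0 hα1 hβ lam ht, rlJ_ksSol hα0 hα1 hβ hμ.le lam ht,
    integral_rpow (Or.inl hμ), Real.zero_rpow (by linarith), sub_zero]
  have hm : μ + 1 ≠ 0 := by linarith
  have hG : Real.Gamma (μ + 1) ≠ 0 := (Real.Gamma_pos_of_pos (by linarith)).ne'
  have e2 : μ + 2 = (μ + 1) + 1 := by ring
  have e3 : (t ^ (μ + 1) / (μ + 1)) • f =
      (t ^ (μ + 1) / Real.Gamma (μ + 2)) • Real.Gamma (μ + 1) • f := by
    rw [smul_smul, e2, Real.Gamma_add_one hm]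
    congr 1
    field_simp
  rw [e3]
  module

end

/-! ### The Fourier coefficients of an arbitrary forward solution -/

section
variable {𝕜 : Type*} [RCLike 𝕜] {H : Type*} [NormedAddCommGroup H]
  [InnerProductSpace 𝕜 H] [CompleteSpace H] [NormedSpace ℝ H] [IsScalarTower ℝ 𝕜 H]
  {v : HilbertBasis ℕ 𝕜 H} {A : H →ₗ.[𝕜] H} {lam : ℕ → ℝ}

variable (v) in
/-- The `k`-th Fourier coefficient, as a real-linear map. -/
def coeffL (k : ℕ) : H →L[ℝ] 𝕜 := (innerSL 𝕜 (v k)).restrictScalars ℝ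

omit [CompleteSpace H] in
lemma coeffL_apply (k : ℕ) (x : H) : coeffL v k x = inner 𝕜 (v k) x := rfl

/-- The Fourier coefficients of a forward solution are the scalar solutions. -/
lemma inner_forwardSolution (hA : IsSelfAdjoint A)
    (hv : ∀ k, (v k, (lam k : 𝕜) • v k) ∈ A.graph) (hlam_pos : ∀ k, 0 < lam k)
    {α β μ : ℝ} (hα0 : 0 < α) (hα1 : α < 1) (hβ : -α < β) (hμ : -1 < μ)
    {I : Set ℝ} (hI0 : I ⊆ Ioi 0) (hI : ∀ t ∈ I, Ioc 0 t ⊆ I) {φ f : H} {u : ℝ → H}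
    (hu : IsForwardSolution A α β μ f φ I u) (k : ℕ) {t : ℝ} (ht : t ∈ I) :
    inner 𝕜 (v k) (u t) =
      modeSol α β μ (lam k) (inner 𝕜 (v k) φ : 𝕜) (inner 𝕜 (v k) f) t := by
  have ht0 : 0 < t := hI0 ht
  set y : ℝ → 𝕜 := modeSol α β μ (lam k) (inner 𝕜 (v k) φ : 𝕜) (inner 𝕜 (v k) f) with hy
  set z : ℝ → 𝕜 := fun s => coeffL v k (u s) - y s with hz
  have hsub : Ioc 0 t ⊆ I := hI t ht
  have hiu : ∀ s ∈ Ioc 0 t, IntervalIntegrable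
      (fun ξ => ((s - ξ) ^ (α - 1 + 1))⁻¹ • coeffL v k (u ξ)) volume 0 s := by
    intro s hs
    have h := hu.integrable s (hsub hs)
    have h2 : IntervalIntegrable
        (fun ξ => coeffL v k (((s - ξ) ^ (α - 1 + 1))⁻¹ • u ξ)) volume 0 s :=
      ⟨(coeffL v k).integrable_comp h.1, (coeffL v k).integrable_comp h.2⟩
    simpa only [map_smul] using h2
  have hiy : ∀ s ∈ Ioc 0 t, IntervalIntegrable
      (fun ξ => ((s - ξ) ^ (α - 1 + 1))⁻¹ • y ξ) volume 0 s := fun s hs =>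
    intervalIntegrable_kernel_smul_modeSol hα0 hα1 hβ hμ _ _ _ hs.1
  have hrz : ∀ s ∈ Ioc 0 t, rlJ (α - 1) z s =
      coeffL v k (rlJ (α - 1) u s) - rlJ (α - 1) y s := by
    intro s hs
    rw [← rlJ_clm (coeffL v k) (hu.integrable s (hsub hs))]
    unfold rlJ
    rw [← smul_sub, ← intervalIntegral.integral_sub (hiu s hs) (hiy s hs)]
    simp only [hz, smul_sub]
  have huc : ContinuousOn u (Ioc 0 t) := hu.continuousOn.mono hsub
  have hyc : ContinuousOn y (Ioc 0 t) :=
    (continuousOn_modeSol hα0 hα1 hβ hμ _ _ _).mono fun s hs => hs.1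
  have hzc : ContinuousOn z (Ioc 0 t) :=
    ((coeffL v k).continuous.comp_continuousOn huc).sub hyc
  -- The open interval is used because at the right end of I the derivative is only one-sided. The
  -- value at t follows by continuity.
  have hzero : ∀ s ∈ Ioo 0 t, z s = 0 := by
    refine eq_zero_of_homogeneous hα0 hα1 hβ (hlam_pos k) ht0 (hzc.mono Ioo_subset_Ioc_self)
      ?_ ?_ ?_ ?_
    · refine ((hiu t ⟨ht0, le_rfl⟩).sub (hiy t ⟨ht0, le_rfl⟩)).congr fun s _ => ?_
      simp only [hz, smul_sub]
    · refine ContinuousOn.congr (((coeffL v k).continuous.comp_continuousOn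
        (hu.continuousOn_rlJ.mono hsub)).sub ?_) hrz
      exact (continuousOn_rlJ_modeSol hα0 hα1 hβ hμ _ _ _).mono fun s hs => hs.1
    · have h1 : Tendsto (fun s => coeffL v k (rlJ (α - 1) u s) - rlJ (α - 1) y s) (𝓝[>] 0)
          (𝓝 (coeffL v k φ - inner 𝕜 (v k) φ)) :=
        (((coeffL v k).continuous.tendsto φ).comp hu.initial).sub
          (tendsto_rlJ_modeSol hα0 hα1 hβ hμ _ _ _)
      rw [coeffL_apply, sub_self] at h1
      refine h1.congr' ?_
      filter_upwards [Ioc_mem_nhdsGT ht0] with s hs using (hrz s hs).symm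
    · intro s hs
      have hsI : s ∈ I := hsub ⟨hs.1, hs.2.le⟩
      have hIn : I ∈ 𝓝 s := mem_of_superset (isOpen_Ioo.mem_nhds hs)
        (Ioo_subset_Ioc_self.trans hsub)
      have hd := ((hu.differentiableOn s hsI).differentiableAt hIn).hasDerivAt
      have heq := hu.equation s hsI
      rw [rlDeriv, derivWithin_of_mem_nhds hIn, ← eq_sub_iff_add_eq] at heq
      rw [heq] at hd
      have h1 := ((coeffL v k).hasFDerivAt.comp_hasDerivAt s hd).sub
        (hasDerivAt_rlJ_modeSol hα0 hα1 hβ hμ (lam k) (inner 𝕜 (v k) φ : 𝕜)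
          (inner 𝕜 (v k) f) hs.1)
      refine (h1.congr_of_eventuallyEq ?_).congr_deriv ?_
      · filter_upwards [isOpen_Ioo.mem_nhds hs] with r hr using hrz r ⟨hr.1, hr.2.le⟩
      · rw [map_sub, map_smul, map_smul, coeffL_apply, coeffL_apply,
          inner_apply_of_eigenvector hA hv k]
        simp only [hz, coeffL_apply, ← hy]
        rw [← RCLike.real_smul_eq_coe_mul]
        module
  have hzt : z t = 0 := by
    have h1 : Tendsto z (𝓝[<] t) (𝓝 (z t)) := by
      have := hzc t ⟨ht0, le_rfl⟩
      refine this.mono_left ?_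
      rw [← nhdsWithin_Ioo_eq_nhdsLT ht0]
      exact nhdsWithin_mono _ Ioo_subset_Ioc_self
    refine tendsto_nhds_unique h1 (tendsto_const_nhds.congr' ?_)
    filter_upwards [Ioo_mem_nhdsLT ht0] with s hs using (hzero s hs).symm
  exact sub_eq_zero.1 hzt

end

/-! ### Existence for the forward problem -/

section
variable {α β μ : ℝ} (hα0 : 0 < α) (hα1 : α < 1) (hβ : -α < β) (hμ : -1 ≤ μ)
include hα0 hα1 hβ hμ

lemma abs_ksSol_le {lam t : ℝ} (hlam : 0 < lam) (ht : 0 < t) :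
    |ksSol α β μ lam t| ≤ t ^ (α + μ) / Real.Gamma (α + μ + 1) := by
  have hx : 0 < lam * t ^ (α + β) := mul_pos hlam (Real.rpow_pos_of_pos ht _)
  have hp : 0 ≤ t ^ (α + μ) / Real.Gamma (α + μ + 1) :=
    div_nonneg (Real.rpow_nonneg ht.le _) (Real.Gamma_pos_of_pos (by linarith)).le
  rw [abs_of_nonneg (ksSol_nonneg hα0 hα1 hβ hμ hlam ht), ksSol, neg_mul]
  exact mul_le_of_le_one_right hp (ksFun_neg_le_one hα0 hα1 hβ hμ hx)

/-- Writing t^(α+μ) = t^(μ-β) t^(α+β) exposes xE(-x) with x = λt^(α+β). The bound is uniform in λ,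
so Au(t) needs no regularity of f. -/
lemma mul_abs_ksSol_le {lam t : ℝ} (hlam : 0 < lam) (ht : 0 < t) :
    lam * |ksSol α β μ lam t| ≤ (μ + 1 + (α + β)) / Real.Gamma (μ + 2) * t ^ (μ - β) := by
  have ht' := Real.rpow_pos_of_pos ht (α + β)
  have hG : 0 < Real.Gamma (α + μ + 1) := Real.Gamma_pos_of_pos (by linarith)
  have h := mul_ksFun_neg_le hα0 hα1 hβ hμ (mul_pos hlam ht')
  rw [abs_of_nonneg (ksSol_nonneg hα0 hα1 hβ hμ hlam ht), ksSol, neg_mul]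
  have e : t ^ (α + μ) = t ^ (μ - β) * t ^ (α + β) := by
    rw [← Real.rpow_add ht]; ring_nf
  rw [e]
  have hp : 0 ≤ t ^ (μ - β) / Real.Gamma (α + μ + 1) :=
    div_nonneg (Real.rpow_nonneg ht.le _) hG.le
  calc _ = t ^ (μ - β) / Real.Gamma (α + μ + 1) *
        (lam * t ^ (α + β) * ksFun α β μ (-(lam * t ^ (α + β)))) := by ring
    _ ≤ t ^ (μ - β) / Real.Gamma (α + μ + 1) *
        ((μ + 1 + (α + β)) * Real.Gamma (α + μ + 1) / Real.Gamma (μ + 2)) :=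
      mul_le_mul_of_nonneg_left h hp
    _ = _ := by field_simp

end

/-- The weight that bounds the modes of a solution. -/
def modeBound (α μ t : ℝ) : ℝ :=
  t ^ (α + -1) / Real.Gamma (α + -1 + 1) +
    t ^ (α + μ) / Real.Gamma (α + μ + 1) * Real.Gamma (μ + 1)

/-- The weight that bounds the modes of the image of a solution under the operator. -/
def modeBoundApply (α β μ t : ℝ) : ℝ :=
  t ^ (α + -1) / Real.Gamma (α + -1 + 1) +
    (μ + 1 + (α + β)) / Real.Gamma (μ + 2) * t ^ (μ - β) * Real.Gamma (μ + 1)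

section
variable {𝕜 : Type*} [RCLike 𝕜] {α β μ : ℝ} (hα0 : 0 < α) (hα1 : α < 1) (hβ : -α < β) (hμ : -1 < μ)
include hα0 hα1 hβ hμ

lemma norm_modeSol_le {lam t : ℝ} (hlam : 0 < lam) (ht : 0 < t) (φ f : 𝕜) :
    ‖modeSol α β μ lam φ f t‖ ≤ modeBound α μ t * (‖φ‖ + ‖f‖) := by
  have hG : 0 < Real.Gamma (μ + 1) := Real.Gamma_pos_of_pos (by linarith)
  have h1 := abs_ksSol_le hα0 hα1 hβ le_rfl hlam ht
  have h2 := abs_ksSol_le hα0 hα1 hβ hμ.le hlam ht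
  set P := t ^ (α + -1) / Real.Gamma (α + -1 + 1)
  set Q := t ^ (α + μ) / Real.Gamma (α + μ + 1)
  have hP : 0 ≤ P := (abs_nonneg _).trans h1
  have hQ : 0 ≤ Q := (abs_nonneg _).trans h2
  refine (norm_add_le _ _).trans ?_
  rw [norm_smul, norm_smul, norm_smul, Real.norm_eq_abs, Real.norm_eq_abs,
    Real.norm_of_nonneg hG.le]
  calc _ ≤ P * ‖φ‖ + Q * (Real.Gamma (μ + 1) * ‖f‖) := by gcongr
    -- The nonnegative cross terms are added so that the bound factors into a function of t and a
    -- sequence independent of t.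
    _ ≤ P * ‖φ‖ + Q * (Real.Gamma (μ + 1) * ‖f‖) +
        (P * ‖f‖ + Q * Real.Gamma (μ + 1) * ‖φ‖) := le_add_of_nonneg_right (by positivity)
    _ = _ := by rw [modeBound]; ring

lemma norm_mul_modeSol_le {lam t : ℝ} (hlam : 0 < lam) (ht : 0 < t) (φ f : 𝕜) :
    ‖(lam : 𝕜) * modeSol α β μ lam φ f t‖ ≤
      modeBoundApply α β μ t * (‖(lam : 𝕜) * φ‖ + ‖f‖) := by
  have hG : 0 < Real.Gamma (μ + 1) := Real.Gamma_pos_of_pos (by linarith)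
  have h1 := abs_ksSol_le hα0 hα1 hβ le_rfl hlam ht
  have h2 := mul_abs_ksSol_le hα0 hα1 hβ hμ.le hlam ht
  set P := t ^ (α + -1) / Real.Gamma (α + -1 + 1)
  set Q := (μ + 1 + (α + β)) / Real.Gamma (μ + 2) * t ^ (μ - β)
  have hP : 0 ≤ P := (abs_nonneg _).trans h1
  have hQ : 0 ≤ Q := (mul_nonneg hlam.le (abs_nonneg _)).trans h2
  have e : (lam : 𝕜) * modeSol α β μ lam φ f t =
      ksSol α β (-1) lam t • ((lam : 𝕜) * φ) +
        (lam * ksSol α β μ lam t) • (Real.Gamma (μ + 1) • f) := by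
    rw [modeSol, ← RCLike.real_smul_eq_coe_mul, ← RCLike.real_smul_eq_coe_mul]
    module
  rw [e]
  refine (norm_add_le _ _).trans ?_
  rw [norm_smul, norm_smul (lam * _), norm_smul, norm_mul lam, Real.norm_eq_abs,
    Real.norm_of_nonneg hlam.le, Real.norm_eq_abs, Real.norm_of_nonneg hG.le]
  calc _ ≤ P * ‖(lam : 𝕜) * φ‖ + Q * (Real.Gamma (μ + 1) * ‖f‖) := by gcongr
    _ ≤ P * ‖(lam : 𝕜) * φ‖ + Q * (Real.Gamma (μ + 1) * ‖f‖) +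
        (P * ‖f‖ + Q * Real.Gamma (μ + 1) * ‖(lam : 𝕜) * φ‖) :=
      le_add_of_nonneg_right (by positivity)
    _ = _ := by rw [modeBoundApply]; ring

omit hα0 hα1 hβ hμ in
lemma continuousOn_rpow_Ioi (p : ℝ) : ContinuousOn (fun s : ℝ => s ^ p) (Ioi 0) := fun _ hs =>
  (Real.continuousAt_rpow_const _ _ (Or.inl (ne_of_gt hs))).continuousWithinAt

omit hα0 hα1 hβ hμ in
lemma continuousOn_modeBound : ContinuousOn (modeBound α μ) (Ioi 0) :=
  ((continuousOn_rpow_Ioi _).div_const _).add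
    (((continuousOn_rpow_Ioi _).div_const _).mul continuousOn_const)

omit hα0 hα1 hβ hμ in
lemma continuousOn_modeBoundApply : ContinuousOn (modeBoundApply α β μ) (Ioi 0) :=
  ((continuousOn_rpow_Ioi _).div_const _).add
    ((continuousOn_const.mul (continuousOn_rpow_Ioi _)).mul continuousOn_const)

omit hα1 hβ in
lemma modeBound_nonneg {t : ℝ} (ht : 0 < t) : 0 ≤ modeBound α μ t := by
  have h1 : 0 < Real.Gamma (α + -1 + 1) := Real.Gamma_pos_of_pos (by linarith)
  have h2 : 0 < Real.Gamma (α + μ + 1) := Real.Gamma_pos_of_pos (by linarith)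
  have h3 : 0 < Real.Gamma (μ + 1) := Real.Gamma_pos_of_pos (by linarith)
  have h4 := Real.rpow_pos_of_pos ht (α + -1)
  have h5 := Real.rpow_pos_of_pos ht (α + μ)
  unfold modeBound
  positivity

lemma modeBoundApply_nonneg {t : ℝ} (ht : 0 < t) : 0 ≤ modeBoundApply α β μ t := by
  have h1 : 0 < Real.Gamma (α + -1 + 1) := Real.Gamma_pos_of_pos (by linarith)
  have h2 : 0 < Real.Gamma (μ + 2) := Real.Gamma_pos_of_pos (by linarith)
  have h3 : 0 < Real.Gamma (μ + 1) := Real.Gamma_pos_of_pos (by linarith)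
  have h4 := Real.rpow_pos_of_pos ht (α + -1)
  have h5 := Real.rpow_pos_of_pos ht (μ - β)
  have h6 : 0 < μ + 1 + (α + β) := by linarith
  unfold modeBoundApply
  positivity

omit hβ in
lemma intervalIntegrable_kernel_mul_modeBound {t : ℝ} (ht : 0 < t) :
    IntervalIntegrable (fun s => ((t - s) ^ (α - 1 + 1))⁻¹ * modeBound α μ s) volume 0 t := by
  have h1 := intervalIntegrable_beta (p := α + -1 + 1) (q := 1 - α) (by linarith) (by linarith) ht
  have h2 := intervalIntegrable_beta (p := α + μ + 1) (q := 1 - α) (by linarith) (by linarith) ht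
  refine ((h1.div_const (Real.Gamma (α + -1 + 1))).add
    (h2.mul_const (Real.Gamma (μ + 1) / Real.Gamma (α + μ + 1)))).congr fun s hs => ?_
  rw [uIoc_of_le ht.le] at hs
  have e2 : 1 - α - 1 = -(α - 1 + 1) := by ring
  simp only [modeBound]
  rw [add_sub_cancel_right, add_sub_cancel_right, e2, Real.rpow_neg (by linarith [hs.2])]
  ring

omit hα0 hα1 in
-- The exponents at 0 are α+β-1 and μ, both greater than -1.
lemma intervalIntegrable_rpow_mul_modeBoundApply {t : ℝ} (ht : 0 < t) :
    IntervalIntegrable (fun s => s ^ β * modeBoundApply α β μ s) volume 0 t := by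
  have h1 : IntervalIntegrable (fun s : ℝ => s ^ (β + (α + -1))) volume 0 t :=
    intervalIntegral.intervalIntegrable_rpow' (by linarith)
  have h2 : IntervalIntegrable (fun s : ℝ => s ^ (β + (μ - β))) volume 0 t :=
    intervalIntegral.intervalIntegrable_rpow' (by linarith)
  refine ((h1.div_const (Real.Gamma (α + -1 + 1))).add
    (h2.mul_const ((μ + 1 + (α + β)) / Real.Gamma (μ + 2) * Real.Gamma (μ + 1)))).congr
    fun s hs => ?_
  rw [uIoc_of_le ht.le] at hs
  simp only [modeBoundApply]
  rw [Real.rpow_add hs.1 β (α + -1), Real.rpow_add hs.1 β (μ - β)]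
  ring

end

lemma summable_add_sq {a b : ℕ → ℝ} (ha : Summable fun k => a k ^ 2)
    (hb : Summable fun k => b k ^ 2) : Summable fun k => (a k + b k) ^ 2 := by
  refine Summable.of_nonneg_of_le (fun k => sq_nonneg _) (fun k => ?_)
    ((ha.add hb).mul_left 2)
  have := sq_nonneg (a k - b k)
  nlinarith

/-! ### The forward solution as a Fourier series -/

section
variable {𝕜 : Type*} [RCLike 𝕜] {H : Type*} [NormedAddCommGroup H]
  [InnerProductSpace 𝕜 H] [CompleteSpace H]
  {v : HilbertBasis ℕ 𝕜 H} {A : H →ₗ.[𝕜] H} {lam : ℕ → ℝ}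

lemma summable_eigenvalue_mul_coeff (hA : IsSelfAdjoint A)
    (hv : ∀ k, (v k, (lam k : 𝕜) • v k) ∈ A.graph) {φ : H} (hφ : φ ∈ A.domain) :
    Summable fun k => ‖(lam k : 𝕜) * (inner 𝕜 (v k) φ : 𝕜)‖ ^ 2 := by
  have h := (hasSum_norm_inner_sq (v := v) (A ⟨φ, hφ⟩)).summable
  simpa only [inner_apply_of_eigenvector hA hv] using h

variable (v lam) in
/-- The Fourier series of the forward solution. -/
def seriesSol (α β μ : ℝ) (φ f : H) (t : ℝ) : H :=
  fourierSum v fun k => modeSol α β μ (lam k) (inner 𝕜 (v k) φ : 𝕜) (inner 𝕜 (v k) f) t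

variable (v lam) in
/-- The Fourier series of the image of the forward solution under the operator. -/
def seriesApply (α β μ : ℝ) (φ f : H) (t : ℝ) : H :=
  fourierSum v fun k =>
    (lam k : 𝕜) * modeSol α β μ (lam k) (inner 𝕜 (v k) φ : 𝕜) (inner 𝕜 (v k) f) t

variable (hlam_pos : ∀ k, 0 < lam k)
  {α β μ : ℝ} (hα0 : 0 < α) (hα1 : α < 1) (hβ : -α < β) (hμ : -1 < μ)
include hlam_pos hα0 hα1 hβ hμ

omit [CompleteSpace H] in
lemma inner_seriesSol (φ f : H) {t : ℝ} (ht : 0 < t) (k : ℕ) :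
    inner 𝕜 (v k) (seriesSol v lam α β μ φ f t) =
      modeSol α β μ (lam k) (inner 𝕜 (v k) φ : 𝕜) (inner 𝕜 (v k) f) t :=
  inner_fourierSum (summable_sq_of_le
    (summable_add_sq (hasSum_norm_inner_sq (v := v) φ).summable
      (hasSum_norm_inner_sq (v := v) f).summable)
    fun k => norm_modeSol_le hα0 hα1 hβ hμ (hlam_pos k) ht _ _) k

lemma inner_seriesApply (hA : IsSelfAdjoint A)
    (hv : ∀ k, (v k, (lam k : 𝕜) • v k) ∈ A.graph) {φ : H} (hφ : φ ∈ A.domain) (f : H)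
    {t : ℝ} (ht : 0 < t) (k : ℕ) :
    inner 𝕜 (v k) (seriesApply v lam α β μ φ f t) = (lam k : 𝕜) *
      modeSol α β μ (lam k) (inner 𝕜 (v k) φ : 𝕜) (inner 𝕜 (v k) f) t :=
  inner_fourierSum (summable_sq_of_le
    (summable_add_sq (summable_eigenvalue_mul_coeff hA hv hφ)
      (hasSum_norm_inner_sq (v := v) f).summable)
    fun k => norm_mul_modeSol_le hα0 hα1 hβ hμ (hlam_pos k) ht _ _) k

lemma isForwardSolution_seriesSol [NormedSpace ℝ H] [IsScalarTower ℝ 𝕜 H] (hA : IsSelfAdjoint A)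
    (hv : ∀ k, (v k, (lam k : 𝕜) • v k) ∈ A.graph)
    {I : Set ℝ} (hI0 : I ⊆ Ioi 0) (hIu : UniqueDiffOn ℝ I) {φ : H} (hφ : φ ∈ A.domain) (f : H) :
    IsForwardSolution A α β μ f φ I (seriesSol v lam α β μ φ f) := by
  set u := seriesSol v lam α β μ φ f with hu
  set g := seriesApply v lam α β μ φ f with hg
  have hb1 := summable_add_sq (hasSum_norm_inner_sq (v := v) φ).summable
      (hasSum_norm_inner_sq (v := v) f).summable
  have hb2 := summable_add_sq (summable_eigenvalue_mul_coeff hA hv hφ)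
      (hasSum_norm_inner_sq (v := v) f).summable
  have hmode := fun k => continuousOn_modeSol hα0 hα1 hβ hμ (lam k) (inner 𝕜 (v k) φ : 𝕜)
    (inner 𝕜 (v k) f)
  have huc : ContinuousOn u (Ioi 0) :=
    continuousOn_fourierSum (r := modeBound α μ) continuousOn_modeBound hb1
      (fun t ht k => norm_modeSol_le hα0 hα1 hβ hμ (hlam_pos k) ht _ _) (fun k => by positivity)
      hmode
  have hgc : ContinuousOn g (Ioi 0) :=
    continuousOn_fourierSum (r := modeBoundApply α β μ) continuousOn_modeBoundApply hb2
      (fun t ht k => norm_mul_modeSol_le hα0 hα1 hβ hμ (hlam_pos k) ht _ _)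
      (fun k => by positivity) (fun k => continuousOn_const.mul (hmode k))
  obtain ⟨B₁, hB₁⟩ : ∃ B, ∀ t, 0 < t → ‖u t‖ ≤ modeBound α μ t * B :=
    ⟨_, fun t ht => norm_fourierSum_le (modeBound_nonneg hα0 hμ ht) hb1
      fun k => norm_modeSol_le hα0 hα1 hβ hμ (hlam_pos k) ht _ _⟩
  obtain ⟨B₂, hB₂⟩ : ∃ B, ∀ t, 0 < t → ‖g t‖ ≤ modeBoundApply α β μ t * B :=
    ⟨_, fun t ht => norm_fourierSum_le (modeBoundApply_nonneg hα0 hα1 hβ hμ ht) hb2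
      fun k => norm_mul_modeSol_le hα0 hα1 hβ hμ (hlam_pos k) ht _ _⟩
  have hsub : ∀ t : ℝ, Ioc 0 t ⊆ Ioi 0 := fun t s hs => hs.1
  have hiu : ∀ t, 0 < t →
      IntervalIntegrable (fun ξ => ((t - ξ) ^ (α - 1 + 1))⁻¹ • u ξ) volume 0 t := by
    intro t ht
    refine ((intervalIntegrable_kernel_mul_modeBound hα0 hα1 hμ ht).mul_const B₁).mono_fun ?_ ?_
    · rw [uIoc_of_le ht.le]
      refine AEStronglyMeasurable.smul ?_
        ((huc.mono (hsub t)).aestronglyMeasurable measurableSet_Ioc)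
      exact Measurable.aestronglyMeasurable (by fun_prop)
    · refine (ae_restrict_iff' measurableSet_uIoc).2 (Eventually.of_forall fun s hs => ?_)
      rw [uIoc_of_le ht.le] at hs
      have hk : 0 ≤ ((t - s) ^ (α - 1 + 1))⁻¹ :=
        inv_nonneg.2 (Real.rpow_nonneg (by linarith [hs.2]) _)
      beta_reduce
      rw [norm_smul, Real.norm_of_nonneg hk]
      refine le_trans ?_ (le_abs_self _)
      rw [mul_assoc]
      exact mul_le_mul_of_nonneg_left (hB₁ s hs.1) hk
  have hgβc : ContinuousOn (fun s : ℝ => s ^ β • g s) (Ioi 0) := (continuousOn_rpow_Ioi β).smul hgc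
  have hig : ∀ t, 0 < t → IntervalIntegrable (fun s : ℝ => s ^ β • g s) volume 0 t := by
    intro t ht
    refine ((intervalIntegrable_rpow_mul_modeBoundApply hβ hμ ht).mul_const
      B₂).mono_fun ?_ ?_
    · rw [uIoc_of_le ht.le]
      exact (hgβc.mono (hsub t)).aestronglyMeasurable measurableSet_Ioc
    · refine (ae_restrict_iff' measurableSet_uIoc).2 (Eventually.of_forall fun s hs => ?_)
      rw [uIoc_of_le ht.le] at hs
      have hk : 0 ≤ s ^ β := Real.rpow_nonneg hs.1.le _
      beta_reduce
      rw [norm_smul, Real.norm_of_nonneg hk]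
      refine le_trans ?_ (le_abs_self _)
      rw [mul_assoc]
      exact mul_le_mul_of_nonneg_left (hB₂ s hs.1) hk
  set h : ℝ → H := fun s => s ^ μ • f - s ^ β • g s with hh
  have hhc : ContinuousOn h (Ioi 0) :=
    ((continuousOn_rpow_Ioi μ).smul continuousOn_const).sub hgβc
  have hih : ∀ t, 0 < t → IntervalIntegrable h volume 0 t := fun t ht =>
    (intervalIntegrable_smul_const (intervalIntegral.intervalIntegrable_rpow' hμ) f).sub (hig t ht)
  have hmodeu : ∀ s, 0 < s → ∀ k, coeffL v k (u s) =
      modeSol α β μ (lam k) (inner 𝕜 (v k) φ : 𝕜) (inner 𝕜 (v k) f) s := fun s hs k =>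
    inner_seriesSol hlam_pos hα0 hα1 hβ hμ φ f hs k
  have hmodeg : ∀ s, 0 < s → ∀ k, coeffL v k (g s) = (lam k : 𝕜) *
      modeSol α β μ (lam k) (inner 𝕜 (v k) φ : 𝕜) (inner 𝕜 (v k) f) s := fun s hs k =>
    inner_seriesApply hlam_pos hα0 hα1 hβ hμ hA hv hφ f hs k
  -- Both sides are compared coefficientwise, since bounded linear maps commute with Bochner
  -- integrals. The fundamental theorem of calculus then gives the fractional derivative.
  have hJ : ∀ t ∈ Ioi (0 : ℝ), rlJ (α - 1) u t = φ + ∫ s in (0 : ℝ)..t, h s := by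
    intro t ht
    refine hilbertBasis_ext (v := v) fun k => ?_
    have e1 := rlJ_clm (coeffL v k) (hiu t ht)
    have e2 := (coeffL v k).intervalIntegral_comp_comm (hih t ht)
    rw [← coeffL_apply, ← coeffL_apply, map_add, ← e1, ← e2]
    have e3 : rlJ (α - 1) (fun s => coeffL v k (u s)) t = rlJ (α - 1)
        (modeSol α β μ (lam k) (inner 𝕜 (v k) φ : 𝕜) (inner 𝕜 (v k) f)) t := by
      unfold rlJ
      congr 1
      refine intervalIntegral.integral_congr_ae (Eventually.of_forall fun s hs => ?_)
      rw [uIoc_of_le (le_of_lt ht)] at hs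
      simp only [hmodeu s hs.1 k]
    rw [e3, (rlJ_modeSol_eq hα0 hα1 hβ hμ _ _ _ ht).2, coeffL_apply]
    congr 1
    refine intervalIntegral.integral_congr_ae (Eventually.of_forall fun s hs => ?_)
    rw [uIoc_of_le (le_of_lt ht)] at hs
    simp only [hh, map_sub, map_smul]
    rw [hmodeg s hs.1 k, coeffL_apply, ← RCLike.real_smul_eq_coe_mul, smul_smul]
  have hder : ∀ t ∈ Ioi (0 : ℝ), HasDerivAt (rlJ (α - 1) u) (h t) t := by
    intro t ht
    have h1 : HasDerivAt (fun t => φ + ∫ s in (0 : ℝ)..t, h s) (h t) t :=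
      (intervalIntegral.integral_hasDerivAt_right (hih t ht)
        (hhc.stronglyMeasurableAtFilter isOpen_Ioi t ht)
        (hhc.continuousAt (Ioi_mem_nhds ht))).const_add φ
    refine h1.congr_of_eventuallyEq ?_
    filter_upwards [Ioi_mem_nhds ht] with s hs using hJ s hs
  have hrl : ∀ t ∈ I, rlDeriv I α u t = h t := fun t ht =>
    (hder t (hI0 ht)).hasDerivWithinAt.derivWithin (hIu t ht)
  have hdom : ∀ t ∈ Ioi (0 : ℝ), ∃ hx : u t ∈ A.domain, A ⟨u t, hx⟩ = g t := fun t ht =>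
    mem_domain_of_coeff hA hv fun k => by
      rw [← coeffL_apply, ← coeffL_apply, hmodeg t ht k, hmodeu t ht k]
  refine
    { continuousOn := huc.mono hI0
      integrable := fun t ht => hiu t (hI0 ht)
      continuousOn_rlJ := fun t ht => (hder t (hI0 ht)).continuousAt.continuousWithinAt
      initial := ?_
      differentiableOn := fun t ht => (hder t (hI0 ht)).differentiableAt.differentiableWithinAt
      continuousOn_rlDeriv := (hhc.mono hI0).congr hrl
      mem_domain := fun t ht => (hdom t (hI0 ht)).1
      continuous_apply := ?_
      equation := ?_ }
  · have h1 := (tendsto_const_nhds (x := φ)).add (tendsto_primitive_zero (hih 1 one_pos))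
    rw [add_zero] at h1
    refine h1.congr' ?_
    filter_upwards [self_mem_nhdsWithin] with t ht using (hJ t ht).symm
  · refine ((hgc.mono hI0).domRestrict).congr fun t => ?_
    exact (hdom t (hI0 t.2)).2.symm
  · intro t ht
    rw [hrl t ht, (hdom t (hI0 ht)).2, hh]
    simp

end

/-! ### The inverse problem -/

section
variable {α β μ : ℝ} (hα0 : 0 < α) (hα1 : α < 1) (hβ : -α < β)
include hα0 hα1 hβ

/-- A zero would contradict the lower bound, whose left-hand side is positive exactly because μ >
-1. -/
lemma ksFun_neg_pos (hμ : -1 < μ) {x : ℝ} (hx : 0 < x) : 0 < ksFun α β μ (-x) := by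
  have hG2 : 0 < Real.Gamma (μ + 2) := Real.Gamma_pos_of_pos (by linarith)
  refine lt_of_le_of_ne (ksFun_neg_nonneg hα0 hα1 hβ hμ.le hx) fun h0 => ?_
  have h := ksFun_neg_lower hα0 hα1 hβ hμ.le hx
  rw [← h0, zero_mul] at h
  exact absurd h (not_le.2 (div_pos (by linarith) hG2))

/-- The final value of the mode driven by the source is bounded below by a multiple of the inverse
eigenvalue. -/
lemma exists_inv_ksSol_le (hμ : -1 < μ) {T l₀ : ℝ} (hT : 0 < T) (hl₀ : 0 < l₀) :
    ∃ C, 0 ≤ C ∧ ∀ lam, l₀ ≤ lam →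
      0 < ksSol α β μ lam T * Real.Gamma (μ + 1) ∧
      (ksSol α β μ lam T * Real.Gamma (μ + 1))⁻¹ ≤ C * lam := by
  have hG : 0 < Real.Gamma (α + μ + 1) := Real.Gamma_pos_of_pos (by linarith)
  have hG1 : 0 < Real.Gamma (μ + 1) := Real.Gamma_pos_of_pos (by linarith)
  have hG2 : 0 < Real.Gamma (μ + 2) := Real.Gamma_pos_of_pos (by linarith)
  have hκ : 0 < (μ + 1) / Real.Gamma (μ + 2) := div_pos (by linarith) hG2
  set κ := (μ + 1) / Real.Gamma (μ + 2)
  have hTd := Real.rpow_pos_of_pos hT (α + β)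
  have hTm := Real.rpow_pos_of_pos hT (α + μ)
  set P := T ^ (α + μ) / Real.Gamma (α + μ + 1) * Real.Gamma (μ + 1) with hP
  have hP0 : 0 < P := by positivity
  -- The lower bound gives 1/E(-x) ≤ 1 + x/(κΓ(α+μ+1)) at x = λT^(α+β). The summand 1 is absorbed by
  -- λ/l₀ ≥ 1.
  refine ⟨P⁻¹ * (l₀⁻¹ + T ^ (α + β) / Real.Gamma (α + μ + 1) / κ), by positivity,
    fun lam hlam => ?_⟩
  have hlam0 : 0 < lam := hl₀.trans_le hlam
  have hx : 0 < lam * T ^ (α + β) := by positivity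
  have hE := ksFun_neg_pos hα0 hα1 hβ hμ hx
  have h := ksFun_neg_lower hα0 hα1 hβ hμ.le hx
  have e : ksSol α β μ lam T * Real.Gamma (μ + 1) =
      P * ksFun α β μ (-(lam * T ^ (α + β))) := by
    rw [ksSol, neg_mul, hP]; ring
  rw [e]
  refine ⟨mul_pos hP0 hE, ?_⟩
  rw [mul_inv, mul_assoc]
  refine mul_le_mul_of_nonneg_left ?_ (by positivity)
  rw [inv_le_iff_one_le_mul₀ hE]
  have h1 : 1 ≤ l₀⁻¹ * lam := by rw [inv_mul_eq_div, one_le_div hl₀]; exact hlam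
  calc (1 : ℝ) ≤ κ⁻¹ * (ksFun α β μ (-(lam * T ^ (α + β))) *
        (κ + lam * T ^ (α + β) / Real.Gamma (α + μ + 1))) := by
        rw [inv_mul_eq_div, one_le_div hκ]; exact h
    _ = ksFun α β μ (-(lam * T ^ (α + β))) *
        (1 + T ^ (α + β) / Real.Gamma (α + μ + 1) / κ * lam) := by field_simp
    _ ≤ ksFun α β μ (-(lam * T ^ (α + β))) *
        (l₀⁻¹ * lam + T ^ (α + β) / Real.Gamma (α + μ + 1) / κ * lam) := by gcongr
    _ = _ := by ring

end

lemma ksSol_neg_one_eq (α β lam t : ℝ) :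
    ksSol α β (-1) lam t = t ^ (α - 1) / Real.Gamma α *
      kilbasSaigo α (1 + β / α) (1 + (β - 1) / α) (-lam * t ^ (α + β)) := by
  rw [ksSol, ksFun, neg_add_cancel_right, ← sub_eq_add_neg, ← sub_eq_add_neg]

lemma modeSol_eq_iff {𝕜 : Type*} [RCLike 𝕜] {α β μ lam T : ℝ}
    (h : ksSol α β μ lam T * Real.Gamma (μ + 1) ≠ 0) (φ f ψ : 𝕜) :
    modeSol α β μ lam φ f T = ψ ↔
      f = (ksSol α β μ lam T * Real.Gamma (μ + 1))⁻¹ • (ψ - ksSol α β (-1) lam T • φ) := by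
  rw [modeSol, smul_smul, add_comm, ← eq_sub_iff_add_eq, eq_inv_smul_iff₀ h]

end

/-! ### The inverse problem: construction of f and conclusion -/

theorem theorem2 {𝕜 : Type*} [RCLike 𝕜] {H : Type*} [NormedAddCommGroup H]
    [InnerProductSpace 𝕜 H] [CompleteSpace H] [NormedSpace ℝ H] [IsScalarTower ℝ 𝕜 H]
    (A : H →ₗ.[𝕜] H) (hA : IsSelfAdjoint A)
    (v : HilbertBasis ℕ 𝕜 H) (lam : ℕ → ℝ)
    (hv : ∀ k, (v k, (lam k : 𝕜) • v k) ∈ A.graph)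
    (hlam_pos : ∀ k, 0 < lam k) (hlam_mono : Monotone lam) (hlam_lim : Tendsto lam atTop atTop)
    (α β μ T : ℝ) (hα0 : 0 < α) (hα1 : α < 1) (hβ : -α < β) (hμ : -1 < μ) (hT : 0 < T)
    (I : Set ℝ) (hI : I = Ioc 0 T ∨ I = Ioi 0)
    (φ Ψ : H) (hφ : φ ∈ A.domain) (hΨ : Ψ ∈ A.domain) :
    ∃ (u : ℝ → H) (f : H),
      -- existence
      IsInverseSolution A α β μ T φ Ψ I u f ∧
      -- uniqueness
      (∀ (u' : ℝ → H) (f' : H), IsInverseSolution A α β μ T φ Ψ I u' f' →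
        f' = f ∧ EqOn u' u I) ∧
      -- the series for `u`
      (∀ t ∈ I, HasSum (fun k : ℕ =>
        (inner 𝕜 (v k) φ * ((t ^ (α - 1) / Real.Gamma α *
              kilbasSaigo α (1 + β / α) (1 + (β - 1) / α) (-lam k * t ^ (α + β)) : ℝ) : 𝕜) +
          inner 𝕜 (v k) f *
            ((Real.Gamma (μ + 1) * t ^ (α + μ) / Real.Gamma (μ + α + 1) *
              kilbasSaigo α (1 + β / α) (1 + (β + μ) / α) (-lam k * t ^ (α + β)) : ℝ) : 𝕜)) •
          v k) (u t)) ∧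
      -- the denominators in the formula for `f_k` do not vanish
      (∀ k, kilbasSaigo α (1 + β / α) (1 + (β + μ) / α) (-lam k * T ^ (α + β)) ≠ 0) ∧
      -- the Fourier coefficients of `f`
      (∀ k, inner 𝕜 (v k) f =
        inner 𝕜 (v k) Ψ * ((Real.Gamma (μ + α + 1) /
            (Real.Gamma (μ + 1) * T ^ (α + μ) *
              kilbasSaigo α (1 + β / α) (1 + (β + μ) / α) (-lam k * T ^ (α + β))) : ℝ) : 𝕜) -
          inner 𝕜 (v k) φ * ((T ^ (α - 1) *
              kilbasSaigo α (1 + β / α) (1 + (β - 1) / α) (-lam k * T ^ (α + β)) *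
              Real.Gamma (μ + α + 1) /
            (Real.Gamma α * Real.Gamma (μ + 1) * T ^ (α + μ) *
              kilbasSaigo α (1 + β / α) (1 + (β + μ) / α) (-lam k * T ^ (α + β))) : ℝ) : 𝕜)) ∧
      HasSum (fun k : ℕ => (inner 𝕜 (v k) f : 𝕜) • v k) f := by
  have hI0 : I ⊆ Ioi 0 := by
    rcases hI with rfl | rfl
    · exact fun t ht => ht.1
    · exact subset_rfl
  have hIc : ∀ t ∈ I, Ioc 0 t ⊆ I := by
    rcases hI with rfl | rfl
    · exact fun t ht => Ioc_subset_Ioc_right ht.2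
    · exact fun t _ s hs => hs.1
  have hIu : UniqueDiffOn ℝ I := by
    rcases hI with rfl | rfl
    · exact uniqueDiffOn_Ioc 0 T
    · exact uniqueDiffOn_Ioi 0
  have hTI : T ∈ I := by
    rcases hI with rfl | rfl
    · exact ⟨hT, le_rfl⟩
    · exact hT
  have hl0 : ∀ k, lam 0 ≤ lam k := fun k => hlam_mono (Nat.zero_le k)
  obtain ⟨C, hC0, hC⟩ := exists_inv_ksSol_le hα0 hα1 hβ hμ hT (hlam_pos 0)
  set S : ℕ → ℝ := fun k => ksSol α β μ (lam k) T * Real.Gamma (μ + 1) with hS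
  have hSpos : ∀ k, 0 < S k := fun k => (hC (lam k) (hl0 k)).1
  -- The final condition u(T) = Ψ solved for f_k, mode by mode (`modeSol_eq_iff`).
  set c : ℕ → 𝕜 := fun k =>
    (S k)⁻¹ • ((inner 𝕜 (v k) Ψ : 𝕜) - ksSol α β (-1) (lam k) T • (inner 𝕜 (v k) φ : 𝕜)) with hc
  set P := T ^ (α + -1) / Real.Gamma (α + -1 + 1) with hP
  have hSφ : ∀ k, |ksSol α β (-1) (lam k) T| ≤ P := fun k =>
    abs_ksSol_le hα0 hα1 hβ le_rfl (hlam_pos k) hT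
  have hP0 : 0 ≤ P := (abs_nonneg _).trans (hSφ 0)
  -- Dividing by S_k costs a factor λ_k, which is paid for by Ψ ∈ D(A) and φ ∈ D(A).
  have hcs : Summable fun k => ‖c k‖ ^ 2 := by
    refine summable_sq_of_le (r := C * (1 + P)) (summable_add_sq
      (summable_eigenvalue_mul_coeff hA hv hΨ) (summable_eigenvalue_mul_coeff hA hv hφ))
      fun k => ?_
    have hl := hlam_pos k
    rw [hc, norm_smul, Real.norm_of_nonneg (inv_nonneg.2 (hSpos k).le), norm_mul, norm_mul,
      RCLike.norm_ofReal, abs_of_pos hl]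
    have h1 : ‖(inner 𝕜 (v k) Ψ : 𝕜) - ksSol α β (-1) (lam k) T • (inner 𝕜 (v k) φ : 𝕜)‖ ≤
        ‖(inner 𝕜 (v k) Ψ : 𝕜)‖ + P * ‖(inner 𝕜 (v k) φ : 𝕜)‖ := by
      refine (norm_sub_le _ _).trans ?_
      rw [norm_smul, Real.norm_eq_abs]
      gcongr
      exact hSφ k
    have h2 := (hC (lam k) (hl0 k)).2
    set p := ‖(inner 𝕜 (v k) Ψ : 𝕜)‖
    set q := ‖(inner 𝕜 (v k) φ : 𝕜)‖
    have hp : 0 ≤ p := norm_nonneg _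
    have hq : 0 ≤ q := norm_nonneg _
    calc _ ≤ C * lam k * (p + P * q) :=
          mul_le_mul h2 h1 (norm_nonneg _) (mul_nonneg hC0 hl.le)
      _ ≤ C * lam k * (p + P * q) + C * lam k * (P * p + q) :=
          le_add_of_nonneg_right (by positivity)
      _ = _ := by ring
  set f : H := fourierSum v c with hf
  have hfk : ∀ k, inner 𝕜 (v k) f = c k := inner_fourierSum hcs
  set u := seriesSol v lam α β μ φ f with hu
  have hfor : IsForwardSolution A α β μ f φ I u :=
    isForwardSolution_seriesSol hlam_pos hα0 hα1 hβ hμ hA hv hI0 hIu hφ f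
  have huk : ∀ t ∈ I, ∀ k, inner 𝕜 (v k) (u t) =
      modeSol α β μ (lam k) (inner 𝕜 (v k) φ : 𝕜) (inner 𝕜 (v k) f) t := fun t ht k =>
    inner_seriesSol hlam_pos hα0 hα1 hβ hμ φ f (hI0 ht) k
  have hG : ∀ m, -1 < m → 0 < Real.Gamma (m + 1) := fun m hm =>
    Real.Gamma_pos_of_pos (by linarith)
  have hks : ∀ k, kilbasSaigo α (1 + β / α) (1 + (β + μ) / α) (-lam k * T ^ (α + β)) ≠ 0 := by
    intro k
    have := ksFun_neg_pos hα0 hα1 hβ hμ (mul_pos (hlam_pos k) (Real.rpow_pos_of_pos hT (α + β)))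
    rw [← neg_mul] at this
    exact this.ne'
  refine ⟨u, f, ⟨hfor, ?_⟩, ?_, ?_, hks, ?_, hasSum_inner_smul f⟩
  · refine hilbertBasis_ext (v := v) fun k => ?_
    rw [huk T hTI k, modeSol_eq_iff (hSpos k).ne', hfk k]
  · intro u' f' hs
    have hk' := fun t (ht : t ∈ I) k => inner_forwardSolution hA hv hlam_pos hα0 hα1 hβ hμ hI0 hIc
      hs.forward k ht
    -- The coefficients of any solution are the scalar solutions, so their values at T determine f';
    -- the equality of u' and u then follows from that of the sources.
    have hff : f' = f := by
      refine hilbertBasis_ext (v := v) fun k => ?_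
      have h1 := hk' T hTI k
      rw [hs.final] at h1
      rw [(modeSol_eq_iff (hSpos k).ne' _ _ _).1 h1.symm, hfk k]
    refine ⟨hff, fun t ht => hilbertBasis_ext (v := v) fun k => ?_⟩
    rw [hk' t ht k, huk t ht k, hff]
  · intro t ht
    refine (hasSum_inner_smul (v := v) (u t)).congr_fun fun k => ?_
    rw [huk t ht k, modeSol, ksSol_neg_one_eq, RCLike.real_smul_eq_coe_mul,
      RCLike.real_smul_eq_coe_mul, RCLike.real_smul_eq_coe_mul, ksSol, ksFun,
      add_comm μ α]
    congr 1
    push_cast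
    ring
  · intro k
    have hE := hks k
    have hTm := (Real.rpow_pos_of_pos hT (α + μ)).ne'
    have hG1 := (hG μ hμ).ne'
    have hG2 : Real.Gamma (α + μ + 1) ≠ 0 := (hG (α + μ) (by linarith)).ne'
    have hG3 : Real.Gamma α ≠ 0 := (Real.Gamma_pos_of_pos hα0).ne'
    rw [hfk k, hc, add_comm μ α]
    simp only [smul_sub, hS, smul_smul]
    rw [RCLike.real_smul_eq_coe_mul, RCLike.real_smul_eq_coe_mul, mul_comm _ (inner 𝕜 (v k) Ψ : 𝕜),
      mul_comm _ (inner 𝕜 (v k) φ : 𝕜), ksSol_neg_one_eq, ksSol, ksFun]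
    generalize kilbasSaigo α (1 + β / α) (1 + (β + μ) / α) (-lam k * T ^ (α + β)) = E at hE
    generalize kilbasSaigo α (1 + β / α) (1 + (β - 1) / α) (-lam k * T ^ (α + β)) = F
    congr 2
    · congr 1
      field_simp
    · congr 1
      field_simp
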